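/- Let $(R,\mathfrak m)$ be a Cohen–Macaulay (Noetherian) local ring of Krull dimension $d>0$ with infinite residue field $R/\mathfrak m$. Let $I$ be an $\mathfrak m$-primary ideal of $R$, and let $J$ be a minimal reduction of $I$; that is, $J$ is minimal with respect to inclusion among the ideals $J'\subseteq I$ such that $I^{m+1}=J'I^m$ for some $m\ge 0$. Let $n\ge 0$ be an integer such that $\lambda(I^{n+1}/JI^n)=1$, where $\lambda$ denotes the length of an $R$-module. Then the following conditions are equivalent: (a) the associated graded ring $\mathrm{gr}_I(R)=\bigoplus_{i\ge 0} I^i/I^{i+1}$ is Cohen–Macaulay; (b) $J\cap I^k=JI^{k-1}$ for all $k=1,\dots,n$, $I^{n+1}\not\subseteq J$, and $I^{n+2}=JI^{n+1}$. -/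

import Mathlib

namespace SallyModules

/-- The depth of a local ring `(A, 𝔪)`: the supremum of the lengths of the `A`-regular sequences
with entries in the maximal ideal `𝔪`. -/
noncomputable def localDepth (A : Type*) [CommRing A] [IsLocalRing A] : ℕ∞ :=
  ⨆ (rs : List A) (_ : RingTheory.Sequence.IsRegular A rs)
    (_ : ∀ r ∈ rs, r ∈ IsLocalRing.maximalIdeal A), (rs.length : ℕ∞)

/-- A Cohen-Macaulay local ring: a Noetherian local ring whose depth equals its Krull dimension. -/
structure IsCohenMacaulayLocalRing (A : Type*) [CommRing A] [IsLocalRing A] : Prop where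
  isNoetherianRing : IsNoetherianRing A
  depth_eq_dim : (localDepth A : WithBot ℕ∞) = ringKrullDim A

/-- A Cohen-Macaulay ring (not necessarily local): a Noetherian ring all of whose localizations at
maximal ideals are Cohen-Macaulay local rings. -/
structure IsCohenMacaulayRing (A : Type*) [CommRing A] : Prop where
  isNoetherianRing : IsNoetherianRing A
  localization : ∀ (P : Ideal A) [P.IsMaximal],
    IsCohenMacaulayLocalRing (Localization.AtPrime P)

/-- The ideal `⨁ Iⁱ⁺¹ tⁱ` of the Rees algebra `R[It] = ⨁ Iⁱ tⁱ`, that is, `I R[It]`. -/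
def reesIdeal {R : Type*} [CommRing R] (I : Ideal R) : Ideal (reesAlgebra I) where
  carrier := {f | ∀ i, (f : Polynomial R).coeff i ∈ I ^ (i + 1)}
  add_mem' hf hg i := by
    simpa using add_mem (hf i) (hg i)
  zero_mem' i := by simp
  smul_mem' c f hf i := by
    rw [smul_eq_mul, Subalgebra.coe_mul, Polynomial.coeff_mul]
    refine Ideal.sum_mem _ ?_
    rintro ⟨j, k⟩ h
    rw [← Finset.HasAntidiagonal.mem_antidiagonal.mp h, add_assoc, pow_add]
    exact Ideal.mul_mem_mul (c.2 j) (hf k)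

/-- The associated graded ring `gr_I(R) = ⨁ Iⁱ/Iⁱ⁺¹`, with the multiplication induced by that of
`R`: the quotient of `R[It] = ⨁ Iⁱ tⁱ` by `⨁ Iⁱ⁺¹ tⁱ`. -/
abbrev AssociatedGradedRing {R : Type*} [CommRing R] (I : Ideal R) : Type _ :=
  reesAlgebra I ⧸ reesIdeal I

/-- `J` is a reduction of `I`: `J ⊆ I` and `Iᵐ⁺¹ = J Iᵐ` for some `m ≥ 0`. -/
def IsReduction {R : Type*} [CommRing R] (I J : Ideal R) : Prop :=
  J ≤ I ∧ ∃ m : ℕ, I ^ (m + 1) = J * I ^ m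

/-- `J` is a minimal reduction of `I`: a reduction of `I` that is minimal, with respect to
inclusion, among the reductions of `I`. -/
def IsMinimalReduction {R : Type*} [CommRing R] (I J : Ideal R) : Prop :=
  Minimal (IsReduction I) J

/-- The length of the `R`-module `M/(N ∩ M)` for ideals `M`, `N` of `R`; this is the length of
`M/N` when `N ⊆ M`. -/
noncomputable def quotientLength {R : Type*} [CommRing R] (M N : Ideal R) : ℕ∞ :=
  Module.length R (M ⧸ Submodule.submoduleOf N M)

end SallyModules

/-! The graded ring is Cohen-Macaulay exactly when `J ∩ I^k = J I^(k-1)` for every `k ≥ 1`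
(Valabrega-Valla, `isCohenMacaulayRing_iff_inf_pow_le`). The length condition settles these
equalities beyond `n` (`forall_inf_pow_le_iff_of_covBy`): no ideal lies strictly between `J I^n` and
`I^(n+1)`, so the equality at `n + 1` says that `I^(n+1)` is not inside `J`. Nakayama gives `𝔪
I^(n+1) ⊆ J I^n`, hence `I^(n+2) ⊆ J`, so the equality at `n + 2` says `I^(n+2) = J I^(n+1)`, which
implies all later ones.

For the criterion, minimality of `J` and the infinite residue field make a smallest generating
family `a` of `J` analytically independent. Comparing the growth of powers of ideals shows that `a`
has `d = dim R` members, so `a` is a regular sequence (`exists_generators_of_isMinimalReduction`).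
When `a` is regular, the equalities mean that the initial forms of `a` in degree one are a regular
sequence of the graded ring `A` (`InitialFormsRegular.inf_pow_le`,
`initialFormsRegular_of_inf_pow_le`, `regularFamily_linearForms_iff`).

It remains to compare regularity of these forms with Cohen-Macaulayness of `A`, which is integral
over the polynomial ring in them. If `A` is Cohen-Macaulay, localize at a prime of height at least
`d` containing the forms (`exists_isPrime_le_height`): they are parameters there, hence regular, and
homogeneity carries this back to `A`. Conversely, an arbitrary maximal ideal `P` contains a monic
polynomial in each form. The top-degree parts are powers of the forms, so these polynomials are a
regular sequence of length `d` (`regularFamily_of_topForm`), and `P` is minimal over them. Depth and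
height at `P` therefore agree. -/

namespace SallyModules

/-! ### Regular sequences and systems of parameters in a Noetherian local ring -/

open RingTheory.Sequence IsLocalRing

/-- If `xs, x` is regular and `xs, w` generate an ideal primary to the maximal ideal, then `xs, w`
is regular. -/
theorem isWeaklyRegular_append_singleton_of_exchange {A : Type*} [CommRing A] [IsLocalRing A]
    [IsNoetherianRing A] {xs : List A} {x w : A} (hx : IsWeaklyRegular A (xs ++ [x]))
    (hxm : x ∈ maximalIdeal A)
    (hw : ∀ p : Ideal A, p.IsPrime → Ideal.ofList (xs ++ [w]) ≤ p → p = maximalIdeal A) :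
    IsWeaklyRegular A (xs ++ [w]) := by
  rw [isWeaklyRegular_append_iff, isWeaklyRegular_singleton_iff] at hx ⊢
  refine ⟨hx.1, ?_⟩
  by_contra hreg
  have hmem : w ∈ ⋃ p ∈ associatedPrimes A (A ⧸ (Ideal.ofList xs • ⊤ : Submodule A A)),
      (p : Set A) := by
    rw [biUnion_associatedPrimes_eq_compl_regular]
    exact hreg
  simp only [Set.mem_iUnion] at hmem
  obtain ⟨p, hp, hwp⟩ := hmem
  have hpp := hp
  rw [AssociatedPrimes.mem_iff, isAssociatedPrime_iff] at hp
  obtain ⟨hprime, q, hq⟩ := hp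
  have hann : ∀ r ∈ Ideal.ofList xs, r ∈ p := by
    intro r hr
    rw [hq, Submodule.mem_colon_singleton, Submodule.mem_bot]
    obtain ⟨b, rfl⟩ := Submodule.Quotient.mk_surjective _ q
    rw [← Submodule.Quotient.mk_smul, Submodule.Quotient.mk_eq_zero]
    exact Submodule.smul_mem_smul hr trivial
  -- A zero divisor `w` modulo `xs` lies in an associated prime. That prime contains `xs` and `w`,
  -- hence is the maximal ideal, so `x` kills the element `q` whose annihilator it is.
  have hpm := hw p hprime (by
    rw [Ideal.ofList_append, Ideal.ofList_singleton]
    exact sup_le hann ((Ideal.span_singleton_le_iff_mem _).2 hwp))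
  have hxq : x • q = 0 := by
    have : x ∈ p := hpm ▸ hxm
    rwa [hq, Submodule.mem_colon_singleton, Submodule.mem_bot] at this
  have hq0 : q = 0 := hx.2 (by simpa using hxq)
  apply hprime.ne_top
  rw [hq, hq0, Ideal.eq_top_iff_one, Submodule.mem_colon_singleton]
  simp

/-- Krull's theorem modulo `K`: one further element `w` already makes the maximal ideal minimal, so
a prime over `K` strictly below the maximal ideal is minimal over `K`, and `z` avoids all of those.
-/
theorem eq_maximalIdeal_of_avoid {A : Type*} [CommRing A] [IsLocalRing A] [IsNoetherianRing A]
    {K : Ideal A} {w z : A}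
    (hw : ∀ p : Ideal A, p.IsPrime → K ⊔ Ideal.span {w} ≤ p → p = maximalIdeal A)
    (hwm : w ∈ maximalIdeal A)
    (hz : ∀ p ∈ K.minimalPrimes, z ∉ p) {p : Ideal A} (hp : p.IsPrime)
    (hle : K ⊔ Ideal.span {z} ≤ p) : p = maximalIdeal A := by
  by_contra hne
  have hlt : p < maximalIdeal A := lt_of_le_of_ne (le_maximalIdeal hp.ne_top) hne
  have hins : ∀ v : A, Ideal.span (insert v (K : Set A)) = K ⊔ Ideal.span {v} := fun v => by
    rw [Ideal.span_insert, Ideal.span_eq, sup_comm]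
  have hmin : maximalIdeal A ∈ (Ideal.span (insert w (K : Set A))).minimalPrimes := by
    rw [hins]
    refine ⟨⟨inferInstance, sup_le ((le_sup_left.trans hle).trans hlt.le)
      ((Ideal.span_singleton_le_iff_mem _).2 hwm)⟩, fun q hq hqm => (hw q hq.1 hq.2).ge⟩
  have h := Ideal.mem_minimalPrimes_span_of_mem_minimalPrimes_span_insert hlt w (K : Set A) hmin
    (K : Set A) (fun a ha => hle (Ideal.mem_sup_left ha))
    (fun a ha => Ideal.le_radical (Ideal.subset_span (Set.mem_insert_of_mem _ ha)))
  rw [Ideal.span_eq] at h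
  exact hz p h (hle (Ideal.mem_sup_right (Ideal.mem_span_singleton_self z)))

/-- A regular sequence forces the height of the maximal ideal to be at least its length; Krull's
height theorem would bound that height by the length of `zs`. -/
theorem not_isMinimalPrime_of_length_lt {A : Type*} [CommRing A] [IsLocalRing A]
    [IsNoetherianRing A] {xs zs : List A} (hx : IsWeaklyRegular A xs)
    (hxm : ∀ x ∈ xs, x ∈ maximalIdeal A) (hlen : zs.length < xs.length) :
    maximalIdeal A ∉ (Ideal.ofList zs).minimalPrimes := by
  classical
  intro h
  have hreg := IsRegular.of_isWeaklyRegular_of_mem_maximalIdeal A hxm hx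
  have h1 := ringKrullDim_add_length_eq_ringKrullDim_of_isRegular xs hreg
  have h2 : (maximalIdeal A).height ≤ (zs.toFinset.card : ℕ∞) := by
    apply Ideal.height_le_card_of_mem_minimalPrimes_span_finset
    simpa [Ideal.ofList] using h
  have h3 := List.toFinset_card_le zs
  have : Nontrivial (A ⧸ Ideal.ofList xs) := Ideal.Quotient.nontrivial_iff.2 fun h =>
    hreg.top_ne_smul (by rw [h]; simp)
  have h4 : (0 : WithBot ℕ∞) ≤ ringKrullDim (A ⧸ Ideal.ofList xs) := ringKrullDim_nonneg_of_nontrivial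
  have h5 : ((xs.length : ℕ∞) : WithBot ℕ∞) ≤ ((maximalIdeal A).height : WithBot ℕ∞) := by
    rw [maximalIdeal_height_eq_ringKrullDim, ← h1]
    exact le_add_of_nonneg_left h4
  have h6 := (WithBot.coe_le_coe.1 h5).trans h2
  have h7 : xs.length ≤ zs.toFinset.card := by exact_mod_cast h6
  omega

/-- In a Noetherian local ring with a regular sequence `xs` whose length is that of a list `ys`
generating an ideal primary to the maximal ideal, `ys` is a regular sequence as well. -/
theorem isWeaklyRegular_of_length_eq {A : Type*} [CommRing A] [IsLocalRing A]
    [IsNoetherianRing A] (xs ys : List A) (hx : IsWeaklyRegular A xs)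
    (hxm : ∀ x ∈ xs, x ∈ maximalIdeal A) (hlen : ys.length = xs.length)
    (hym : ∀ y ∈ ys, y ∈ maximalIdeal A)
    (hy : ∀ p : Ideal A, p.IsPrime → Ideal.ofList ys ≤ p → p = maximalIdeal A) :
    IsWeaklyRegular A ys := by
  induction hn : xs.length generalizing A with
  | zero =>
    rw [List.length_eq_zero_iff] at hn
    subst hn
    rw [List.length_nil, List.length_eq_zero_iff] at hlen
    subst hlen
    exact hx
  | succ n ih =>
    obtain ⟨xs, x, rfl⟩ : ∃ xs' x, xs = xs' ++ [x] :=
      ⟨_, _, (List.dropLast_append_getLast (by rintro rfl; simp at hn)).symm⟩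
    obtain ⟨ys, y, rfl⟩ : ∃ ys' y, ys = ys' ++ [y] :=
      ⟨_, _, (List.dropLast_append_getLast (by rintro rfl; simp at hlen)).symm⟩
    have hxs : xs.length = n := by simpa using hn
    have hys : ys.length = n := by simp at hlen; omega
    have hxm' : ∀ a ∈ xs, a ∈ maximalIdeal A := fun a ha => hxm a (by simp [ha])
    have hym' : ∀ a ∈ ys, a ∈ maximalIdeal A := fun a ha => hym a (by simp [ha])
    -- The list `ys` bounds the dimension by `n + 1`, and the regular sequence lowers it by `n + 1`,
    -- so the quotient by `xs ++ [x]` has dimension at most zero.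
    have hxprim : ∀ p : Ideal A, p.IsPrime → Ideal.ofList (xs ++ [x]) ≤ p →
        p = maximalIdeal A := by
      intro p hp hle
      by_contra hne
      have hlt := lt_of_le_of_ne (le_maximalIdeal hp.ne_top) hne
      have hreg := IsRegular.of_isWeaklyRegular_of_mem_maximalIdeal A hxm hx
      have h1 := ringKrullDim_add_length_eq_ringKrullDim_of_isRegular _ hreg
      classical
      have h2 : (maximalIdeal A).height ≤ ((ys ++ [y]).toFinset.card : ℕ∞) := by
        apply Ideal.height_le_card_of_mem_minimalPrimes_span_finset
        have : maximalIdeal A ∈ (Ideal.ofList (ys ++ [y])).minimalPrimes :=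
          ⟨⟨inferInstance, Ideal.span_le.2 hym⟩, fun q hq _ => (hy q hq.1 hq.2).ge⟩
        simpa only [Ideal.ofList, List.coe_toFinset] using this
      have h3 : ringKrullDim A ≤ (n + 1 : ℕ) := by
        rw [← maximalIdeal_height_eq_ringKrullDim]
        have h4 := List.toFinset_card_le (ys ++ [y])
        rw [List.length_append, hys, List.length_singleton] at h4
        exact WithBot.coe_le_coe.2 (h2.trans (by exact_mod_cast h4))
      have h5 : ringKrullDim (A ⧸ Ideal.ofList (xs ++ [x])) ≤ 0 := by
        rw [← h1, hn] at h3
        generalize ringKrullDim (A ⧸ Ideal.ofList (xs ++ [x])) = D at h3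
        induction D with
        | bot => exact bot_le
        | coe D =>
          have h7 : D + ((n + 1 : ℕ) : ℕ∞) ≤ ((n + 1 : ℕ) : ℕ∞) := WithBot.coe_le_coe.1 h3
          have h8 : D + ((n + 1 : ℕ) : ℕ∞) ≤ 0 + ((n + 1 : ℕ) : ℕ∞) := by simpa using h7
          exact WithBot.coe_le_coe.2 ((ENat.add_le_add_iff_right (ENat.natCast_ne_top _)).1 h8)
      have h6 : Ring.KrullDimLE 0 (A ⧸ Ideal.ofList (xs ++ [x])) :=
        Ring.krullDimLE_iff.2 (by exact_mod_cast h5)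
      rw [Ideal.krullDimLE_zero_quotient_iff_forall_minimalPrimes_isMaximal] at h6
      obtain ⟨p₀, hp₀, hle₀⟩ := Ideal.exists_minimalPrimes_le hle
      exact hne (le_antisymm hlt.le (eq_maximalIdeal (h6 p₀ hp₀) ▸ hle₀))
    -- Prime avoidance gives one element `z` that can replace the last entry of both lists. Permuted
    -- to the front, it is divided out and the induction applies to the shortened lists.
    obtain ⟨z, hzm, hz⟩ : ∃ z ∈ maximalIdeal A,
        ∀ p ∈ (Ideal.ofList xs).minimalPrimes ∪ (Ideal.ofList ys).minimalPrimes, z ∉ p := by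
      by_contra! hcon
      have hsub : (maximalIdeal A : Set A) ⊆
          ⋃ p ∈ (Ideal.ofList xs).minimalPrimes ∪ (Ideal.ofList ys).minimalPrimes, (p : Set A) := by
        intro z hz
        obtain ⟨p, hp, hzp⟩ := hcon z hz
        exact Set.mem_biUnion hp hzp
      obtain ⟨p, hp, hle⟩ := (Ideal.subset_union_prime_finite
        ((Ideal.finite_minimalPrimes_of_isNoetherianRing A _).union
          (Ideal.finite_minimalPrimes_of_isNoetherianRing A _)) (f := id) ⊥ ⊥
          (fun p hp _ _ => hp.elim (fun h => h.1.1) (fun h => h.1.1))).1 hsub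
      have hpm : p = maximalIdeal A := le_antisymm
        (le_maximalIdeal (hp.elim (fun h => h.1.1.ne_top) (fun h => h.1.1.ne_top))) hle
      rw [hpm] at hp
      exact hp.elim (not_isMinimalPrime_of_length_lt hx hxm (by simp))
        (not_isMinimalPrime_of_length_lt hx hxm (by simp; omega))
    have hofl : ∀ (l : List A) (a : A), Ideal.ofList (l ++ [a]) = Ideal.ofList l ⊔ Ideal.span {a} :=
      fun l a => by rw [Ideal.ofList_append, Ideal.ofList_singleton]
    have key : ∀ (l : List A) (a : A), (∀ p ∈ (Ideal.ofList l).minimalPrimes, z ∉ p) →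
        (∀ p : Ideal A, p.IsPrime → Ideal.ofList (l ++ [a]) ≤ p → p = maximalIdeal A) →
        a ∈ maximalIdeal A →
        ∀ p : Ideal A, p.IsPrime → Ideal.ofList (l ++ [z]) ≤ p → p = maximalIdeal A := by
      intro l a hl ha ham p hp hle
      rw [hofl] at hle
      exact eq_maximalIdeal_of_avoid (by simpa only [hofl] using ha) ham hl hp hle
    have hxz := isWeaklyRegular_append_singleton_of_exchange hx (hxm x (by simp))
      (key xs x (fun p hp => hz p (.inl hp)) hxprim (hxm x (by simp)))
    have hyz := key ys y (fun p hp => hz p (.inr hp)) hy (hym y (by simp))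
    have hzx := isWeaklyRegular_of_perm_of_subset_maximalIdeal hxz
      (List.perm_append_singleton z xs) (by
        simp only [List.mem_append, List.mem_singleton]
        rintro r (hr | rfl)
        exacts [hxm' r hr, hzm])
    have : Nontrivial (A ⧸ Ideal.span {z}) := Ideal.Quotient.nontrivial_iff.2 fun h =>
      (maximalIdeal.isMaximal A).ne_top (top_le_iff.1
        (h ▸ (Ideal.span_singleton_le_iff_mem _).2 hzm))
    have : IsLocalRing (A ⧸ Ideal.span {z}) :=
      .of_surjective' (Ideal.Quotient.mk _) Ideal.Quotient.mk_surjective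
    let e : QuotSMulTop z A ≃ₗ[A] (A ⧸ Ideal.span {z}) :=
      Submodule.quotEquivOfEq _ _ (by rw [← Submodule.ideal_span_singleton_smul]; simp)
    have hcons : ∀ l : List A, IsWeaklyRegular A (z :: l) ↔ IsSMulRegular A z ∧
        IsWeaklyRegular (A ⧸ Ideal.span {z}) (l.map (algebraMap A (A ⧸ Ideal.span {z}))) := by
      intro l
      rw [isWeaklyRegular_cons_iff, isWeaklyRegular_map_algebraMap_iff, e.isWeaklyRegular_congr]
    have hmax : ∀ l : List A, (∀ a ∈ l, a ∈ maximalIdeal A) →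
        ∀ a ∈ l.map (algebraMap A (A ⧸ Ideal.span {z})),
          a ∈ maximalIdeal (A ⧸ Ideal.span {z}) := by
      intro l hl a ha
      obtain ⟨b, hb, rfl⟩ := List.mem_map.1 ha
      have : IsLocalHom (Ideal.Quotient.mk (Ideal.span {z})) :=
        .of_surjective _ Ideal.Quotient.mk_surjective
      exact ((local_hom_TFAE (Ideal.Quotient.mk (Ideal.span {z}))).out 0 2 rfl rfl).1 this
        (Ideal.mem_map_of_mem _ (hl b hb))
    rw [hcons] at hzx
    have hzy := ih (A := A ⧸ Ideal.span {z}) _ (ys.map (algebraMap A (A ⧸ Ideal.span {z})))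
      hzx.2 (hmax xs hxm') (by simp [hxs, hys]) (hmax ys hym')
      (by
        intro p hp hle
        have hcomap := hyz (p.comap (algebraMap A (A ⧸ Ideal.span {z}))) inferInstance (by
          rw [hofl]
          refine sup_le ?_ ?_
          · rw [← Ideal.map_le_iff_le_comap, Ideal.map_ofList]
            exact hle
          · rw [Ideal.span_singleton_le_iff_mem, Ideal.mem_comap]
            have : algebraMap A (A ⧸ Ideal.span {z}) z = 0 :=
              Ideal.Quotient.eq_zero_iff_mem.2 (Ideal.mem_span_singleton_self z)
            rw [this]
            exact zero_mem _)
        have hpmax : p.IsMaximal :=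
          Ideal.isMaximal_of_isIntegral_of_isMaximal_comap (R := A) p
            (hcomap ▸ maximalIdeal.isMaximal A)
        exact eq_maximalIdeal hpmax)
      (by simp [hxs])
    have hyz' := isWeaklyRegular_of_perm_of_subset_maximalIdeal ((hcons ys).2 ⟨hzx.1, hzy⟩)
      (List.perm_append_singleton z ys).symm (by
        simp only [List.mem_cons]
        rintro r (rfl | hr)
        exacts [hzm, hym' r hr])
    exact isWeaklyRegular_append_singleton_of_exchange hyz' hzm hy

end SallyModules

/-! ### Regular sequences in graded rings: leading forms and descent from a localization -/

namespace SallyModules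

open RingTheory.Sequence IsLocalRing

/-- A family `s₀, …, s_{d-1}` of elements of a ring is a weakly regular sequence. -/
def RegularFamily {A : Type*} [CommRing A] {d : ℕ} (s : Fin d → A) : Prop :=
  ∀ (i : Fin d) (b : A), s i * b ∈ Ideal.span (s '' Set.Iio i) → b ∈ Ideal.span (s '' Set.Iio i)

theorem ofList_take_ofFn {A : Type*} [CommRing A] {d : ℕ} (s : Fin d → A) (i : Fin d) :
    Ideal.ofList ((List.ofFn s).take i) = Ideal.span (s '' Set.Iio i) := by
  unfold Ideal.ofList
  congr 1
  ext x
  simp only [Set.mem_ofPred_eq, List.mem_take_iff_getElem, Set.mem_image, Set.mem_Iio]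
  constructor
  · rintro ⟨j, hj, rfl⟩
    simp only [List.length_ofFn, lt_min_iff] at hj
    exact ⟨⟨j, hj.2⟩, hj.1, by simp⟩
  · rintro ⟨j, hj, rfl⟩
    exact ⟨j, by simpa using hj, by simp⟩

theorem isWeaklyRegular_ofFn_iff {A : Type*} [CommRing A] {d : ℕ} (s : Fin d → A) :
    IsWeaklyRegular A (List.ofFn s) ↔ RegularFamily s := by
  have key : ∀ (K : Ideal A) (r : A),
      IsSMulRegular (A ⧸ (K • ⊤ : Submodule A A)) r ↔ ∀ b, r * b ∈ K → b ∈ K := by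
    intro K r
    rw [isSMulRegular_iff_right_eq_zero_of_smul]
    have hK : (K • ⊤ : Submodule A A) = K := by simp
    constructor
    · intro h b hb
      have := h (Submodule.Quotient.mk b) (by
        rw [← Submodule.Quotient.mk_smul, Submodule.Quotient.mk_eq_zero, hK]
        exact hb)
      rwa [Submodule.Quotient.mk_eq_zero, hK] at this
    · intro h b hb
      obtain ⟨b, rfl⟩ := Submodule.Quotient.mk_surjective _ b
      rw [← Submodule.Quotient.mk_smul, Submodule.Quotient.mk_eq_zero, hK] at hb
      rw [Submodule.Quotient.mk_eq_zero, hK]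
      exact h b hb
  rw [isWeaklyRegular_iff]
  simp_rw [key]
  constructor
  · intro h i b hb
    have := h i (by simp) b
    rw [ofList_take_ofFn] at this
    exact this (by simpa using hb)
  · intro h i hi b
    have hi' : i < d := by simpa using hi
    have := h ⟨i, hi'⟩ b
    rw [← ofList_take_ofFn] at this
    simpa using this

/-- An element of the ideal generated by `s₀, …, s_{i-1}` as a combination. -/
theorem mem_span_image_iff_exists {A : Type*} [CommRing A] {d : ℕ} (s : Fin d → A) (t : Set (Fin d))
    (x : A) : x ∈ Ideal.span (s '' t) ↔
      ∃ c : Fin d → A, (∀ j, j ∉ t → c j = 0) ∧ x = ∑ j, s j * c j := by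
  classical
  constructor
  · intro hx
    induction hx using Submodule.span_induction with
    | mem x hx =>
      obtain ⟨j, hj, rfl⟩ := hx
      refine ⟨Pi.single j 1, fun k hk => Pi.single_eq_of_ne (fun h => hk (by rwa [h])) _, ?_⟩
      simp [Pi.single_apply]
    | zero => exact ⟨0, by simp, by simp⟩
    | add x y _ _ hx hy =>
      obtain ⟨c, hc, rfl⟩ := hx
      obtain ⟨c', hc', rfl⟩ := hy
      exact ⟨c + c', fun j hj => by simp [hc j hj, hc' j hj], by
        simp [mul_add, Finset.sum_add_distrib]⟩
    | smul r x _ hx =>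
      obtain ⟨c, hc, rfl⟩ := hx
      exact ⟨r • c, fun j hj => by simp [hc j hj], by
        simp [Finset.mul_sum, mul_left_comm]⟩
  · rintro ⟨c, hc, rfl⟩
    refine Ideal.sum_mem _ fun j _ => ?_
    by_cases hj : j ∈ t
    · exact Ideal.mul_mem_right _ _ (Ideal.subset_span ⟨j, hj, rfl⟩)
    · simp [hc j hj]

section Graded

open DirectSum

variable {R A : Type*} [CommRing R] [CommRing A] [Algebra R A] (𝒜 : ℕ → Submodule R A)
  [GradedAlgebra 𝒜]

/-- The elements of a graded ring whose components vanish in degrees at least `k`. -/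
def degreeLT (k : ℕ) : Submodule R A where
  carrier := {x | ∀ j, k ≤ j → GradedRing.proj 𝒜 j x = 0}
  add_mem' hx hy j hj := by rw [map_add, hx j hj, hy j hj, add_zero]
  zero_mem' j _ := map_zero _
  smul_mem' r x hx j hj := by
    have := hx j hj
    rw [GradedRing.proj_apply] at this ⊢
    simp [decompose_smul, DirectSum.smul_apply, this]

variable {𝒜}

theorem degreeLT_mono {k l : ℕ} (h : k ≤ l) : degreeLT 𝒜 k ≤ degreeLT 𝒜 l :=
  fun _ hx j hj => hx j (h.trans hj)

theorem eq_zero_of_mem_degreeLT_zero {x : A} (hx : x ∈ degreeLT 𝒜 0) : x = 0 := by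
  classical
  rw [← sum_support_decompose 𝒜 x]
  exact Finset.sum_eq_zero fun j _ => hx j (Nat.zero_le j)

theorem exists_mem_degreeLT (x : A) : ∃ k, x ∈ degreeLT 𝒜 k := by
  classical
  refine ⟨((decompose 𝒜 x).support.sup id) + 1, fun j hj => ?_⟩
  by_contra h
  have : j ∈ (decompose 𝒜 x).support := by
    rw [DFinsupp.mem_support_iff]
    intro h0
    exact h (by rw [GradedRing.proj_apply, h0]; rfl)
  have := Finset.le_sup (f := id) this
  simp at this
  omega

theorem mem_degreeLT_of_mem {k l : ℕ} (h : k < l) {x : A} (hx : x ∈ 𝒜 k) : x ∈ degreeLT 𝒜 l := by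
  intro j hj
  rw [GradedRing.proj_apply]
  exact decompose_of_mem_ne 𝒜 hx (by omega)

theorem mul_mem_degreeLT {k l : ℕ} {x y : A} (hx : x ∈ degreeLT 𝒜 k) (hy : y ∈ degreeLT 𝒜 (l + 1)) :
    x * y ∈ degreeLT 𝒜 (k + l) := by
  classical
  have h : ∀ {i} (x : A), x ∈ degreeLT 𝒜 i →
      ∃ (s : Finset ℕ) (f : ℕ → A), x = ∑ j ∈ s, f j ∧ ∀ j ∈ s, j < i ∧ f j ∈ 𝒜 j := by
    intro i x hx
    refine ⟨(decompose 𝒜 x).support, fun j => decompose 𝒜 x j,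
      (sum_support_decompose 𝒜 x).symm, fun j hj => ⟨?_, SetLike.coe_mem _⟩⟩
    by_contra hij
    have := hx j (not_lt.1 hij)
    rw [DFinsupp.mem_support_iff] at hj
    exact hj (Subtype.ext this)
  obtain ⟨s, f, rfl, hf⟩ := h x hx
  obtain ⟨s', f', rfl, hf'⟩ := h y hy
  rw [Finset.sum_mul_sum]
  refine Submodule.sum_mem _ fun i hi => Submodule.sum_mem _ fun j hj => ?_
  have h1 := hf i hi
  have h2 := hf' j hj
  exact mem_degreeLT_of_mem (by omega) (SetLike.GradedMul.mul_mem h1.2 h2.2)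

theorem sub_proj_mem_degreeLT {k : ℕ} {x : A} (hx : x ∈ degreeLT 𝒜 (k + 1)) :
    x - GradedRing.proj 𝒜 k x ∈ degreeLT 𝒜 k := by
  intro j hj
  rw [map_sub, GradedRing.proj_apply, GradedRing.proj_apply, GradedRing.proj_apply]
  rcases hj.eq_or_lt with rfl | hj
  · rw [decompose_coe, of_eq_same, sub_self]
  · rw [decompose_of_mem_ne 𝒜 (SetLike.coe_mem _) hj.ne, sub_zero]
    exact hx j hj

theorem proj_mul_of_left_mem {k l : ℕ} {x : A} (hx : x ∈ 𝒜 k) (y : A) (h : k ≤ l) :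
    GradedRing.proj 𝒜 l (x * y) = x * GradedRing.proj 𝒜 (l - k) y := by
  rw [GradedRing.proj_apply, GradedRing.proj_apply, coe_decompose_mul_of_left_mem_of_le 𝒜 hx h]

variable {d : ℕ} {s h : Fin d → A} {e : Fin d → ℕ}

theorem mem_degreeLT_succ_of_sub_mem {s h : A} {e : ℕ} (hh : h ∈ 𝒜 e)
    (hs : s - h ∈ degreeLT 𝒜 e) : s ∈ degreeLT 𝒜 (e + 1) := by
  rw [← sub_add_cancel s h]
  exact add_mem (degreeLT_mono e.le_succ hs) (mem_degreeLT_of_mem e.lt_succ_self hh)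

theorem mul_mem_degreeLT_of_sub_mem {s h : A} {e k : ℕ} (hh : h ∈ 𝒜 e)
    (hs : s - h ∈ degreeLT 𝒜 e) {c : A} (hc : c ∈ degreeLT 𝒜 (k - e)) :
    s * c ∈ degreeLT 𝒜 k := by
  -- For `k ≤ e` the truncated difference is zero, and the only element of degree below zero is `0`.
  rcases le_or_gt k e with hk | hk
  · rw [Nat.sub_eq_zero_of_le hk] at hc
    rw [eq_zero_of_mem_degreeLT_zero hc, mul_zero]
    exact zero_mem _
  · have hs' := mem_degreeLT_succ_of_sub_mem hh hs
    obtain ⟨m, rfl⟩ : ∃ m, k = e + m + 1 := ⟨k - e - 1, by omega⟩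
    rw [show e + m + 1 - e = m + 1 by omega] at hc
    have := mul_mem_degreeLT hs' hc
    rwa [show e + 1 + m = e + m + 1 by omega] at this

theorem proj_mul_of_sub_mem {s h : A} {e k : ℕ} (hh : h ∈ 𝒜 e)
    (hs : s - h ∈ degreeLT 𝒜 e) {c : A} (hc : c ∈ degreeLT 𝒜 (k + 1 - e)) :
    ∃ c', GradedRing.proj 𝒜 k (s * c) = h * c' := by
  rcases le_or_gt (k + 1) e with hk | hk
  · rw [Nat.sub_eq_zero_of_le hk] at hc
    exact ⟨0, by rw [eq_zero_of_mem_degreeLT_zero hc, mul_zero, map_zero, mul_zero]⟩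
  · refine ⟨GradedRing.proj 𝒜 (k - e) c, ?_⟩
    rw [← sub_add_cancel s h, add_mul, map_add, proj_mul_of_left_mem hh _ (by omega)]
    have h1 : (s - h) * c ∈ degreeLT 𝒜 (e + (k - e)) :=
      mul_mem_degreeLT hs (by rwa [show k - e + 1 = k + 1 - e by omega])
    rw [h1 k (by omega), zero_add]

/-- The ideal generated by `s₀, …, s_{n-1}` is strict for the degree filtration. -/
def StrictBelow (𝒜 : ℕ → Submodule R A) [GradedAlgebra 𝒜] (s : Fin d → A) (e : Fin d → ℕ)
    (n : ℕ) : Prop :=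
  ∀ k, ∀ y ∈ Ideal.span (s '' {j | (j : ℕ) < n}), y ∈ degreeLT 𝒜 k →
    ∃ c : Fin d → A, (∀ j, c j ∈ degreeLT 𝒜 (k - e j)) ∧ (∀ j : Fin d, n ≤ (j : ℕ) → c j = 0) ∧
      y = ∑ j, s j * c j

/-- Clears the leading term of `b` modulo the earlier `s`. The component of `u + s i * b` in degree
`j + e i` vanishes, and strictness puts that of `u` in the ideal of the earlier `h`; regularity of
`h` then expresses the degree `j` part of `b` through these `h`, and the same coefficients with `s`
in place of `h` give `v`. -/
theorem exists_sub_mem_degreeLT_of_strictBelow (hh : ∀ i, h i ∈ 𝒜 (e i))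
    (hs : ∀ i, s i - h i ∈ degreeLT 𝒜 (e i)) (hreg : RegularFamily h) (i : Fin d)
    (hi : StrictBelow 𝒜 s e i) {j : ℕ} {b u : A} (hb : b ∈ degreeLT 𝒜 (j + 1))
    (hu : u ∈ Ideal.span (s '' Set.Iio i)) (hub : u + s i * b ∈ degreeLT 𝒜 (j + e i)) :
    ∃ v ∈ Ideal.span (s '' Set.Iio i), b - v ∈ degreeLT 𝒜 j := by
  classical
  have hsb : s i * b ∈ degreeLT 𝒜 (j + e i + 1) :=
    mul_mem_degreeLT_of_sub_mem (hh i) (hs i) (by rwa [show j + e i + 1 - e i = j + 1 by omega])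
  have hu' : u ∈ degreeLT 𝒜 (j + e i + 1) := by
    rw [← add_sub_cancel_right u (s i * b)]
    exact sub_mem (degreeLT_mono (Nat.le_succ _) hub) hsb
  obtain ⟨c, hc, hc0, hcu⟩ := hi _ u hu hu'
  have hproj : GradedRing.proj 𝒜 (j + e i) u + h i * GradedRing.proj 𝒜 j b = 0 := by
    have h1 := hub (j + e i) le_rfl
    rw [map_add] at h1
    rw [← h1]
    congr 1
    rw [← sub_add_cancel (s i) (h i), add_mul, map_add, proj_mul_of_left_mem (hh i) _ (by omega)]
    have h2 : (s i - h i) * b ∈ degreeLT 𝒜 (e i + j) := mul_mem_degreeLT (hs i) hb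
    rw [h2 (j + e i) (by omega), zero_add, Nat.add_sub_cancel]
  have hmem : h i * GradedRing.proj 𝒜 j b ∈ Ideal.span (h '' Set.Iio i) := by
    rw [← neg_eq_of_add_eq_zero_right hproj, hcu, map_sum]
    refine neg_mem (Ideal.sum_mem _ fun l _ => ?_)
    by_cases hl : l < i
    · obtain ⟨c', hc'⟩ := proj_mul_of_sub_mem (hh l) (hs l) (hc l)
      rw [hc']
      exact Ideal.mul_mem_right _ _ (Ideal.subset_span ⟨l, hl, rfl⟩)
    · rw [hc0 l (by simpa using hl), mul_zero, map_zero]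
      exact zero_mem _
  obtain ⟨f, hf0, hf⟩ := (mem_span_image_iff_exists h _ _).1 (hreg i _ hmem)
  -- Only the part of `f l` in degree `j - e l` contributes in degree `j`. Keeping just this part
  -- makes the difference between `s l * g l` and `h l * g l` have degree below `j`.
  let g : Fin d → A := fun l => if e l ≤ j then GradedRing.proj 𝒜 (j - e l) (f l) else 0
  have hg0 : ∀ l, l ∉ Set.Iio i → g l = 0 := fun l hl => by
    simp only [g, hf0 l hl, map_zero, ite_self]
  have hbg : GradedRing.proj 𝒜 j b = ∑ l, h l * g l := by
    have h1 : GradedRing.proj 𝒜 j (GradedRing.proj 𝒜 j b) = GradedRing.proj 𝒜 j b := by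
      simp [GradedRing.proj_apply]
    rw [← h1, hf, map_sum]
    refine Finset.sum_congr rfl fun l _ => ?_
    simp only [g]
    split_ifs with hl
    · exact proj_mul_of_left_mem (hh l) _ hl
    · rw [GradedRing.proj_apply, coe_decompose_mul_of_left_mem_of_not_le 𝒜 (hh l) hl, mul_zero]
  refine ⟨∑ l, s l * g l, (mem_span_image_iff_exists s _ _).2 ⟨g, hg0, rfl⟩, ?_⟩
  have h1 : b - ∑ l, s l * g l =
      (b - GradedRing.proj 𝒜 j b) - ∑ l, (s l - h l) * g l := by
    rw [hbg]
    simp only [sub_mul, Finset.sum_sub_distrib]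
    ring
  rw [h1]
  refine sub_mem (sub_proj_mem_degreeLT hb) (sum_mem fun l _ => ?_)
  simp only [g]
  split_ifs with hl
  · have := mul_mem_degreeLT (hs l)
      (mem_degreeLT_of_mem (𝒜 := 𝒜) (Nat.lt_succ_self (j - e l))
        (x := GradedRing.proj 𝒜 (j - e l) (f l)) (SetLike.coe_mem _))
    rwa [Nat.add_sub_cancel' hl] at this
  · rw [mul_zero]
    exact zero_mem _

theorem strictBelow_of_regularFamily (hh : ∀ i, h i ∈ 𝒜 (e i))
    (hs : ∀ i, s i - h i ∈ degreeLT 𝒜 (e i)) (hreg : RegularFamily h) (n : ℕ) (hn : n ≤ d) :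
    StrictBelow 𝒜 s e n := by
  classical
  induction n with
  | zero =>
    intro k y hy _
    refine ⟨0, fun _ => zero_mem _, fun _ _ => rfl, ?_⟩
    simpa using hy
  | succ n ih =>
    have ih := ih (by omega)
    intro k y hy hyk
    let i : Fin d := ⟨n, hn⟩
    have hset : {j : Fin d | (j : ℕ) < n + 1} = insert i (Set.Iio i) := by
      ext j
      simp only [Set.mem_ofPred_eq, Set.mem_insert_iff, Set.mem_Iio, Fin.ext_iff, Fin.lt_def, i]
      omega
    -- The degree of the coefficient `b` of the last generator is lowered one step at a time, the
    -- corrections being absorbed in `u`, until it is below `k - e i`.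
    have key : ∀ m : ℕ, ∀ u ∈ Ideal.span (s '' Set.Iio i), ∀ b ∈ degreeLT 𝒜 m,
        y = u + s i * b → ∃ u' ∈ Ideal.span (s '' Set.Iio i), ∃ b' ∈ degreeLT 𝒜 (k - e i),
          y = u' + s i * b' := by
      intro m
      induction m with
      | zero => exact fun u hu b hb hyu => ⟨u, hu, b, degreeLT_mono (Nat.zero_le _) hb, hyu⟩
      | succ m ihm =>
        intro u hu b hb hyu
        by_cases hm : m + 1 ≤ k - e i
        · exact ⟨u, hu, b, degreeLT_mono hm hb, hyu⟩
        · obtain ⟨v, hv, hbv⟩ := exists_sub_mem_degreeLT_of_strictBelow hh hs hreg i ih hb hu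
            (by rw [← hyu]; exact degreeLT_mono (by omega) hyk)
          exact ihm (u + s i * v) (add_mem hu (Ideal.mul_mem_left _ _ hv)) (b - v) hbv
            (by rw [hyu]; ring)
    rw [hset, Set.image_insert_eq, Ideal.span_insert, Submodule.mem_sup] at hy
    obtain ⟨w, hw, u, hu, rfl⟩ := hy
    obtain ⟨b, rfl⟩ := Ideal.mem_span_singleton'.1 hw
    obtain ⟨m, hm⟩ := exists_mem_degreeLT (𝒜 := 𝒜) b
    obtain ⟨u', hu', b', hb', hy'⟩ := key m u hu b hm (by ring)
    obtain ⟨c, hc, hc0, hcu⟩ := ih k u' hu' (by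
      rw [← add_sub_cancel_right u' (s i * b'), ← hy']
      exact sub_mem hyk (mul_mem_degreeLT_of_sub_mem (hh i) (hs i) hb'))
    refine ⟨c + Pi.single i b', fun j => ?_, fun j hj => ?_, ?_⟩
    · rw [Pi.add_apply]
      refine add_mem (hc j) ?_
      by_cases hj : j = i
      · subst hj
        simpa using hb'
      · rw [Pi.single_eq_of_ne hj]
        exact zero_mem _
    · rw [Pi.add_apply, hc0 j (by omega), Pi.single_eq_of_ne, add_zero]
      rintro rfl
      simp [i] at hj
    · rw [hy', hcu]
      simp [mul_add, Finset.sum_add_distrib, Pi.single_apply]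

/-- Elements whose top-degree forms are a regular sequence are a regular sequence. -/
theorem regularFamily_of_topForm (hh : ∀ i, h i ∈ 𝒜 (e i))
    (hs : ∀ i, s i - h i ∈ degreeLT 𝒜 (e i)) (hreg : RegularFamily h) : RegularFamily s := by
  intro i b hb
  have hstrict := strictBelow_of_regularFamily hh hs hreg i i.2.le
  have key : ∀ m : ℕ, ∀ b ∈ degreeLT 𝒜 m, s i * b ∈ Ideal.span (s '' Set.Iio i) →
      b ∈ Ideal.span (s '' Set.Iio i) := by
    intro m
    induction m with
    | zero =>
      intro b hb _
      rw [eq_zero_of_mem_degreeLT_zero hb]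
      exact zero_mem _
    | succ m ihm =>
      intro b hb hsb
      -- Applied with `u = -(s i * b)`: the sum is zero, so the leading term of `b` can be cleared
      -- in every degree.
      obtain ⟨v, hv, hbv⟩ := exists_sub_mem_degreeLT_of_strictBelow hh hs hreg i hstrict hb
        (neg_mem hsb) (by rw [neg_add_cancel]; exact zero_mem _)
      have := ihm (b - v) hbv (by rw [mul_sub]; exact sub_mem hsb (Ideal.mul_mem_left _ _ hv))
      rw [← sub_add_cancel b v]
      exact add_mem this hv
  obtain ⟨m, hm⟩ := exists_mem_degreeLT (𝒜 := 𝒜) b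
  exact key m b hm hb

/-- A sequence of homogeneous elements that is regular in the localization at a maximal ideal
outside of which the elements have invertible degree zero component is regular. -/
theorem regularFamily_of_localization (hh : ∀ i, h i ∈ 𝒜 (e i)) (M : Ideal A) [M.IsPrime]
    (hM : ∀ x, x ∉ M → IsUnit (GradedRing.proj 𝒜 0 x))
    (hreg : RegularFamily (fun i => algebraMap A (Localization.AtPrime M) (h i))) :
    RegularFamily h := by
  classical
  intro i b hb
  have hhom : (Ideal.span (h '' Set.Iio i)).IsHomogeneous 𝒜 := by
    apply Ideal.homogeneous_span
    rintro _ ⟨j, _, rfl⟩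
    exact ⟨e j, hh j⟩
  have hmap : (Ideal.span (h '' Set.Iio i)).map (algebraMap A (Localization.AtPrime M)) =
      Ideal.span ((fun i => algebraMap A (Localization.AtPrime M) (h i)) '' Set.Iio i) := by
    rw [Ideal.map_span, Set.image_image]
  have key : ∀ k, ∀ c ∈ 𝒜 k, h i * c ∈ Ideal.span (h '' Set.Iio i) →
      c ∈ Ideal.span (h '' Set.Iio i) := by
    intro k c hc hic
    have h1 := hreg i (algebraMap A _ c) (by
      rw [← map_mul, ← hmap]
      exact Ideal.mem_map_of_mem _ hic)
    rw [← hmap, IsLocalization.algebraMap_mem_map_algebraMap_iff M.primeCompl] at h1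
    obtain ⟨r, hr, hrc⟩ := h1
    -- Since the ideal is homogeneous, it contains the degree `k` part of `r * c`, which is the
    -- degree zero part of `r` times `c`; the former is a unit.
    have h2 := hhom k hrc
    have h3 : ((decompose 𝒜 (r * c)) k : A) = GradedRing.proj 𝒜 0 r * c := by
      rw [coe_decompose_mul_of_right_mem_of_le 𝒜 hc le_rfl, Nat.sub_self, GradedRing.proj_apply]
    rw [h3] at h2
    exact (Ideal.unit_mul_mem_iff_mem _ (hM r hr)).1 h2
  rw [← sum_support_decompose 𝒜 b]
  refine Ideal.sum_mem _ fun k _ => key k _ (SetLike.coe_mem _) ?_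
  have := hhom (e i + k) hb
  rwa [coe_decompose_mul_of_left_mem_of_le 𝒜 (hh i) (Nat.le_add_right _ _),
    Nat.add_sub_cancel_left] at this

end Graded

end SallyModules

/-! ### The Valabrega-Valla criterion, one generator at a time -/

namespace SallyModules

section Step

variable {R : Type*} [CommRing R] {I K : Ideal R} {x : R}

/-- Write `y = u + x * b` and push `b` into higher powers of `I`. While `b` is only known to be in
`I ^ m` with `m + 2 ≤ k`, the depth of `y` puts `x * b` in `K * I ^ m ⊔ I ^ (m + 2)`, and `h`
improves `b` modulo `K`. -/
theorem sup_inf_pow_le (hx : x ∈ I) (hK : ∀ k, K ⊓ I ^ k ≤ K * I ^ (k - 1))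
    (h : ∀ k, ∀ b ∈ I ^ k, x * b ∈ K * I ^ k ⊔ I ^ (k + 2) → b ∈ K * I ^ (k - 1) ⊔ I ^ (k + 1))
    (k : ℕ) : (Ideal.span {x} ⊔ K) ⊓ I ^ k ≤ (Ideal.span {x} ⊔ K) * I ^ (k - 1) := by
  have hxb : ∀ m b, b ∈ I ^ m → x * b ∈ I ^ (m + 1) := fun m b hb => by
    rw [pow_succ']
    exact Ideal.mul_mem_mul hx hb
  rintro y ⟨hy, hyk⟩
  have key : ∀ m ≤ k - 1, ∃ u ∈ K, ∃ b ∈ I ^ m, y = u + x * b := by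
    intro m
    induction m with
    | zero =>
      intro _
      obtain ⟨w, hw, u, hu, rfl⟩ := Submodule.mem_sup.1 hy
      obtain ⟨b, rfl⟩ := Ideal.mem_span_singleton'.1 hw
      exact ⟨u, hu, b, by simp, by ring⟩
    | succ m ihm =>
      intro hm
      obtain ⟨u, hu, b, hb, rfl⟩ := ihm (by omega)
      have hu' : u ∈ K * I ^ m := by
        refine hK (m + 1) ⟨hu, ?_⟩
        rw [← add_sub_cancel_right u (x * b)]
        exact sub_mem (Ideal.pow_le_pow_right (by omega) hyk) (hxb m b hb)
      have hab : x * b ∈ K * I ^ m ⊔ I ^ (m + 2) := by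
        rw [← add_sub_cancel_left u (x * b)]
        exact sub_mem (Ideal.mem_sup_right (Ideal.pow_le_pow_right (by omega) hyk))
          (Ideal.mem_sup_left hu')
      obtain ⟨v, hv, b', hb', hvb⟩ := Submodule.mem_sup.1 (h m b hb hab)
      have hv' : v ∈ K := Ideal.mul_le_left hv
      refine ⟨u + x * v, add_mem hu (Ideal.mul_mem_left _ _ hv'), b', hb', ?_⟩
      rw [← hvb]
      ring
  obtain ⟨u, hu, b, hb, rfl⟩ := key (k - 1) le_rfl
  have hab : x * b ∈ I ^ k := Ideal.pow_le_pow_right (by omega) (hxb _ b hb)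
  have hu' : u ∈ K * I ^ (k - 1) := by
    refine hK k ⟨hu, ?_⟩
    rw [← add_sub_cancel_right u (x * b)]
    exact sub_mem hyk hab
  exact add_mem (Ideal.mul_mono_left le_sup_right hu')
    (Ideal.mul_mem_mul (Ideal.mem_sup_left (Ideal.mem_span_singleton_self _)) hb)

/-- In `y = x * b + u` with `u ∈ K * I ^ k`, regularity of `x` modulo `K` gives `b ∈ K ⊓ I ^ k`. The
induction hypothesis puts `b` in `K * I ^ (k - 1)`, and the factor `x ∈ I` restores the missing
power. -/
theorem inf_pow_le_of_sup (hx : x ∈ I) (hreg : ∀ b, x * b ∈ K → b ∈ K)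
    (h : ∀ k, (Ideal.span {x} ⊔ K) ⊓ I ^ k ≤ (Ideal.span {x} ⊔ K) * I ^ (k - 1)) (k : ℕ) :
    K ⊓ I ^ k ≤ K * I ^ (k - 1) := by
  induction k with
  | zero => simp
  | succ k ihk =>
    rintro y ⟨hy, hyk⟩
    have h1 := h (k + 1) ⟨Ideal.mem_sup_right hy, hyk⟩
    rw [Nat.add_sub_cancel, Ideal.sup_mul] at h1
    obtain ⟨w, hw, u, hu, rfl⟩ := Submodule.mem_sup.1 h1
    obtain ⟨b, hb, rfl⟩ := Ideal.mem_span_singleton_mul.1 hw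
    have hu' : u ∈ K := Ideal.mul_le_left hu
    have h2 : x * b ∈ K := by
      rw [← add_sub_cancel_right (x * b) u]
      exact sub_mem hy hu'
    rw [Nat.add_sub_cancel]
    refine add_mem ?_ hu
    rcases Nat.eq_zero_or_pos k with rfl | hk
    · simpa using h2
    · have h3 : x * b ∈ I * (K * I ^ (k - 1)) := Ideal.mul_mem_mul hx (ihk ⟨hreg b h2, hb⟩)
      rwa [mul_left_comm, ← pow_succ', Nat.sub_add_cancel hk] at h3

/-- The summand of `x * b` in `I ^ (k + 2)` also lies in `(x) + K`, so `h` rewrites it as `x * b' +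
v` with `b' ∈ I ^ (k + 1)`. Then `x * (b - b')` is in `K`, and regularity together with `hK` handles
`b - b'`. -/
theorem mem_of_mul_mem_of_sup (hreg : ∀ b, x * b ∈ K → b ∈ K)
    (hK : ∀ k, K ⊓ I ^ k ≤ K * I ^ (k - 1))
    (h : ∀ k, (Ideal.span {x} ⊔ K) ⊓ I ^ k ≤ (Ideal.span {x} ⊔ K) * I ^ (k - 1)) (k : ℕ)
    {b : R} (hb : b ∈ I ^ k) (hxb : x * b ∈ K * I ^ k ⊔ I ^ (k + 2)) :
    b ∈ K * I ^ (k - 1) ⊔ I ^ (k + 1) := by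
  obtain ⟨u, hu, w, hw, huw⟩ := Submodule.mem_sup.1 hxb
  have hu' : u ∈ K := Ideal.mul_le_left hu
  have h1 : w ∈ (Ideal.span {x} ⊔ K) * I ^ (k + 1) := by
    refine h (k + 2) ⟨?_, hw⟩
    rw [← add_sub_cancel_left u w, huw]
    exact sub_mem (Ideal.mem_sup_left (Ideal.mul_mem_right _ _ (Ideal.mem_span_singleton_self x)))
      (Ideal.mem_sup_right hu')
  rw [Ideal.sup_mul] at h1
  obtain ⟨w', hw', v, hv, rfl⟩ := Submodule.mem_sup.1 h1
  obtain ⟨b', hb', rfl⟩ := Ideal.mem_span_singleton_mul.1 hw'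
  have hv' : v ∈ K := Ideal.mul_le_left hv
  have h2 : b - b' ∈ K := by
    apply hreg
    have : x * (b - b') = u + v := by rw [mul_sub, ← huw]; ring
    rw [this]
    exact add_mem hu' hv'
  rw [← sub_add_cancel b b']
  exact add_mem (Ideal.mem_sup_left (hK k ⟨h2,
    sub_mem hb (Ideal.pow_le_pow_right (Nat.le_succ k) hb')⟩)) (Ideal.mem_sup_right hb')

end Step

variable {R : Type*} [CommRing R] {d : ℕ}

/-- The initial forms of `a₀, …, a_{d-1} ∈ I` in the associated graded ring of `I` form a regular
sequence, expressed in terms of elements of the ring. -/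
def InitialFormsRegular (I : Ideal R) (a : Fin d → R) : Prop :=
  ∀ (i : Fin d) (k : ℕ), ∀ b ∈ I ^ k,
    a i * b ∈ Ideal.span (a '' Set.Iio i) * I ^ k ⊔ I ^ (k + 2) →
    b ∈ Ideal.span (a '' Set.Iio i) * I ^ (k - 1) ⊔ I ^ (k + 1)

theorem span_image_lt_succ (a : Fin d → R) {n : ℕ} (hn : n < d) :
    Ideal.span (a '' {j : Fin d | (j : ℕ) < n + 1}) =
      Ideal.span {a ⟨n, hn⟩} ⊔ Ideal.span (a '' {j : Fin d | (j : ℕ) < n}) := by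
  rw [← Ideal.span_insert, ← Set.image_insert_eq]
  congr 2
  ext j
  simp only [Set.mem_ofPred_eq, Set.mem_insert_iff, Fin.ext_iff]
  omega

theorem span_image_lt_self (a : Fin d → R) :
    Ideal.span (a '' {j : Fin d | (j : ℕ) < d}) = Ideal.span (Set.range a) := by
  have : {j : Fin d | (j : ℕ) < d} = Set.univ := Set.eq_univ_of_forall fun j => j.2
  rw [this, Set.image_univ]

/-- One direction of the Valabrega-Valla criterion. -/
theorem InitialFormsRegular.inf_pow_le {I : Ideal R} {a : Fin d → R} (h : InitialFormsRegular I a)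
    (ha : ∀ i, a i ∈ I) (k : ℕ) :
    Ideal.span (Set.range a) ⊓ I ^ k ≤ Ideal.span (Set.range a) * I ^ (k - 1) := by
  have key : ∀ n ≤ d, ∀ k, Ideal.span (a '' {j : Fin d | (j : ℕ) < n}) ⊓ I ^ k ≤
      Ideal.span (a '' {j : Fin d | (j : ℕ) < n}) * I ^ (k - 1) := by
    intro n
    induction n with
    | zero => simp
    | succ n ih =>
      intro hn
      rw [span_image_lt_succ a hn]
      exact sup_inf_pow_le (ha _) (ih (by omega)) (h ⟨n, hn⟩)
  have := key d le_rfl k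
  rwa [span_image_lt_self] at this

/-- The other direction of the Valabrega-Valla criterion. -/
theorem initialFormsRegular_of_inf_pow_le {I : Ideal R} {a : Fin d → R} (hreg : RegularFamily a)
    (ha : ∀ i, a i ∈ I)
    (h : ∀ k, Ideal.span (Set.range a) ⊓ I ^ k ≤ Ideal.span (Set.range a) * I ^ (k - 1)) :
    InitialFormsRegular I a := by
  -- The equalities descend from the whole family to each initial segment, so the induction runs
  -- downwards from `d`.
  have key : ∀ n ≤ d, ∀ k, Ideal.span (a '' {j : Fin d | (j : ℕ) < n}) ⊓ I ^ k ≤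
      Ideal.span (a '' {j : Fin d | (j : ℕ) < n}) * I ^ (k - 1) := by
    intro n hn
    induction hn using Nat.decreasingInduction with
    | self => rwa [span_image_lt_self]
    | of_succ n hn ih =>
      rw [span_image_lt_succ a hn] at ih
      exact inf_pow_le_of_sup (ha _) (hreg ⟨n, hn⟩) ih
  intro i k b hb hab
  have hn := key (i + 1) i.2
  rw [span_image_lt_succ a i.2] at hn
  exact mem_of_mul_mem_of_sup (hreg i) (key i i.2.le) hn k hb hab

end SallyModules

/-! ### Analytic independence of minimal generators of a minimal reduction -/

namespace SallyModules

open IsLocalRing MvPolynomial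

section Homogeneous

variable {R σ : Type*} [CommRing R]

theorem isHomogeneous_sum_eq [Fintype σ] {f : MvPolynomial σ R} {j : ℕ} (hf : f.IsHomogeneous j)
    {α : σ →₀ ℕ} (hα : α ∈ f.support) : ∑ i, α i = j := by
  have := hf (mem_support_iff.1 hα)
  rwa [← Finsupp.degree_eq_sum, Finsupp.degree_eq_weight_one]

theorem eval_mul_of_isHomogeneous [Fintype σ] {f : MvPolynomial σ R} {j : ℕ} (hf : f.IsHomogeneous j)
    (c : σ → R) (w : R) : eval (fun i => c i * w) f = w ^ j * eval c f := by
  rw [eval_eq', eval_eq', Finset.mul_sum]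
  refine Finset.sum_congr rfl fun α hα => ?_
  rw [← isHomogeneous_sum_eq hf hα]
  simp_rw [mul_pow, Finset.prod_mul_distrib, Finset.prod_pow_eq_pow_sum]
  ring

/-- Telescoping: changing one factor from `x i` to `y i` leaves a difference in `K`, and the
remaining factors stay in `J`. -/
theorem prod_map_sub_prod_map_mem {J K : Ideal R} {x y : σ → R} (hx : ∀ i, x i ∈ J)
    (hy : ∀ i, y i ∈ J) (hxy : ∀ i, x i - y i ∈ K) (s : Multiset σ) :
    (s.map x).prod - (s.map y).prod ∈ K * J ^ (s.card - 1) := by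
  have hmem : ∀ s : Multiset σ, (s.map y).prod ∈ J ^ s.card := by
    intro s
    induction s using Multiset.induction_on with
    | empty => simp
    | cons i s ih =>
      rw [Multiset.map_cons, Multiset.prod_cons, Multiset.card_cons, pow_succ']
      exact Ideal.mul_mem_mul (hy i) ih
  induction s using Multiset.induction_on with
  | empty => simp
  | cons i s ih =>
    simp only [Multiset.map_cons, Multiset.prod_cons, Multiset.card_cons, Nat.add_sub_cancel]
    have h1 : x i * (s.map x).prod - y i * (s.map y).prod =
        x i * ((s.map x).prod - (s.map y).prod) + (x i - y i) * (s.map y).prod := by ring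
    rw [h1]
    refine add_mem ?_ (Ideal.mul_mem_mul (hxy i) (hmem s))
    rcases Multiset.empty_or_exists_mem s with rfl | ⟨k, hk⟩
    · simp
    · have hpos : 0 < s.card := Multiset.card_pos_iff_exists_mem.2 ⟨k, hk⟩
      have h2 := Ideal.mul_mem_mul (hx i) ih
      rwa [mul_left_comm, ← pow_succ', Nat.sub_add_cancel hpos] at h2

theorem prod_map_toMultiset [Fintype σ] (z : σ → R) (α : σ →₀ ℕ) :
    ((Finsupp.toMultiset α).map z).prod = ∏ i, z i ^ α i := by
  rw [Finsupp.toMultiset_map, Finsupp.prod_toMultiset, Finsupp.prod_mapDomain_index (by simp)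
    (by intros; rw [pow_add]), Finsupp.prod_fintype _ _ (by simp)]

theorem eval_sub_eval_mem [Fintype σ] {J K : Ideal R} {x y : σ → R} (hx : ∀ i, x i ∈ J)
    (hy : ∀ i, y i ∈ J) (hxy : ∀ i, x i - y i ∈ K) {f : MvPolynomial σ R} {j : ℕ}
    (hf : f.IsHomogeneous j) : eval x f - eval y f ∈ K * J ^ (j - 1) := by
  classical
  rw [eval_eq', eval_eq', ← Finset.sum_sub_distrib]
  refine Ideal.sum_mem _ fun α hα => ?_
  rw [← mul_sub]
  refine Ideal.mul_mem_left _ _ ?_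
  have := prod_map_sub_prod_map_mem hx hy hxy (Finsupp.toMultiset α)
  rw [Finsupp.card_toMultiset, Finsupp.sum_fintype _ _ (fun _ => rfl), show ∑ i, id (α i) = ∑ i, α i from rfl,
    isHomogeneous_sum_eq hf hα] at this
  rwa [prod_map_toMultiset, prod_map_toMultiset] at this

theorem eval_mem_pow [Fintype σ] {J : Ideal R} {x : σ → R} (hx : ∀ i, x i ∈ J) {f : MvPolynomial σ R} {j : ℕ}
    (hf : f.IsHomogeneous j) : eval x f ∈ J ^ j := by
  rw [eval_eq']
  refine Ideal.sum_mem _ fun α hα => Ideal.mul_mem_left _ _ ?_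
  rw [← isHomogeneous_sum_eq hf hα, ← Finset.prod_pow_eq_pow_sum]
  exact Ideal.prod_mem_prod fun i _ => Ideal.pow_mem_pow (hx i) _

end Homogeneous

/-- Expanding factor by factor, a product of elements of `J` either picks up a factor from `K` or
has all its factors in `P`. -/
theorem pow_succ_le_mul_pow_sup {R : Type*} [CommRing R] {J K P : Ideal R} (h : J ≤ K ⊔ P)
    (hP : P ≤ J) (j : ℕ) : J ^ (j + 1) ≤ K * J ^ j ⊔ P ^ (j + 1) := by
  induction j with
  | zero => simpa using h
  | succ j ih =>
    calc J ^ (j + 1 + 1) = J * J ^ (j + 1) := pow_succ' _ _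
      _ ≤ (K ⊔ P) * J ^ (j + 1) := Ideal.mul_mono_left h
      _ = K * J ^ (j + 1) ⊔ P * J ^ (j + 1) := Ideal.sup_mul _ _ _
      _ ≤ K * J ^ (j + 1) ⊔ P * (K * J ^ j ⊔ P ^ (j + 1)) :=
        sup_le_sup_left (Ideal.mul_mono_right ih) _
      _ ≤ K * J ^ (j + 1) ⊔ P ^ (j + 1 + 1) := by
        rw [Ideal.mul_sup, ← pow_succ']
        refine sup_le le_sup_left (sup_le (le_sup_of_le_left ?_) le_sup_right)
        rw [mul_left_comm, pow_succ' J]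
        exact Ideal.mul_mono_right (Ideal.mul_mono_left hP)

theorem IsReduction.pow_add_eq {R : Type*} [CommRing R] {I J : Ideal R} {m : ℕ}
    (hm : I ^ (m + 1) = J * I ^ m) (i : ℕ) : I ^ (m + i) = J ^ i * I ^ m := by
  induction i with
  | zero => simp
  | succ i ih =>
    rw [← add_assoc, pow_succ', ih, mul_left_comm, ← pow_succ', hm, ← mul_assoc, ← pow_succ]

variable {R : Type*} [CommRing R] [IsLocalRing R] [IsNoetherianRing R] {I J : Ideal R} {l : ℕ}

/-- A minimal generating family of a minimal reduction of `I` is analytically independent. -/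
theorem IsMinimalReduction.coeff_mem_maximalIdeal [Infinite (ResidueField R)]
    (hJ : IsMinimalReduction I J)
    {a : Fin l → R} (ha : Ideal.span (Set.range a) = J)
    (hmin : ∀ s : Finset R, Ideal.span (s : Set R) = J → l ≤ s.card)
    {f : MvPolynomial (Fin l) R} {j : ℕ} (hf : f.IsHomogeneous j)
    (hfa : eval a f ∈ maximalIdeal R * J ^ j) (α : Fin l →₀ ℕ) :
    f.coeff α ∈ maximalIdeal R := by
  classical
  by_contra hα
  have haJ : ∀ i, a i ∈ J := fun i => ha ▸ Ideal.subset_span ⟨i, rfl⟩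
  have hne : MvPolynomial.map (residue R) f ≠ 0 := by
    intro h0
    apply hα
    rw [← residue_eq_zero_iff, ← coeff_map, h0, coeff_zero]
  -- Here the residue field must be infinite: a nonzero polynomial over it has a point where it does
  -- not vanish.
  obtain ⟨c₀, hc₀⟩ : ∃ c, eval c (MvPolynomial.map (residue R) f) ≠ 0 := by
    by_contra! h
    exact hne (MvPolynomial.funext fun x => by rw [h x, map_zero])
  choose c hc using fun i => residue_surjective (c₀ i)
  have hunit : IsUnit (eval c f) := by
    rw [← notMem_maximalIdeal, ← residue_eq_zero_iff]
    have : c₀ = residue R ∘ c := funext fun i => (hc i).symm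
    rwa [this, ← map_eval] at hc₀
  obtain ⟨j, rfl⟩ : ∃ j', j = j' + 1 := by
    refine Nat.exists_eq_succ_of_ne_zero ?_
    rintro rfl
    have h1 := eval_mul_of_isHomogeneous hf a 0
    have h2 := eval_mul_of_isHomogeneous hf c 0
    simp only [mul_zero, pow_zero, one_mul] at h1 h2
    rw [← h1, h2, pow_zero, mul_one] at hfa
    exact hfa hunit
  obtain ⟨p, hp⟩ : ∃ p, IsUnit (c p) := by
    by_contra! hcon
    have h1 := eval_mem_pow (J := maximalIdeal R) (x := c) hcon hf
    exact Ideal.pow_le_self (Nat.succ_ne_zero j) h1 hunit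
  obtain ⟨u, hu⟩ := hp
  -- With `w = a p / c p`, the elements `a i - c i * w` together with `w` generate `J`, and the one
  -- with index `p` is zero. The aim is to show that `K` is already a reduction, which contradicts
  -- the minimal number of generators.
  let w : R := ↑u⁻¹ * a p
  have hw : a p = u * w := by simp [w]
  have hwJ : w ∈ J := Ideal.mul_mem_left _ _ (haJ p)
  let K : Ideal R := Ideal.span (Set.range fun i => a i - c i * w)
  have hKJ : K ≤ J := by
    rw [Ideal.span_le]
    rintro _ ⟨i, rfl⟩
    exact sub_mem (haJ i) (Ideal.mul_mem_left _ _ hwJ)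
  have hJK : J ≤ K ⊔ Ideal.span {w} := by
    rw [← ha, Ideal.span_le]
    rintro _ ⟨i, rfl⟩
    have h1 : a i = (a i - c i * w) + c i * w := by ring
    rw [h1]
    exact add_mem (Ideal.mem_sup_left (Ideal.subset_span ⟨i, rfl⟩))
      (Ideal.mem_sup_right (Ideal.mul_mem_left _ _ (Ideal.mem_span_singleton_self w)))
  have hsub := eval_sub_eval_mem (K := K) (y := fun i => c i * w) haJ
    (fun i => Ideal.mul_mem_left _ _ hwJ) (fun i => Ideal.subset_span ⟨i, rfl⟩) hf
  rw [eval_mul_of_isHomogeneous hf, Nat.add_sub_cancel] at hsub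
  -- Modulo `K * J ^ j` the value of `f` at `a` is `w ^ (j + 1)` times the unit `eval c f`; Nakayama
  -- then removes the second summand from `J ^ (j + 1)`.
  have hwpow : w ^ (j + 1) ∈ K * J ^ j ⊔ maximalIdeal R * J ^ (j + 1) := by
    rw [← Ideal.mul_unit_mem_iff_mem _ hunit]
    have h1 : w ^ (j + 1) * eval c f = eval a f - (eval a f - w ^ (j + 1) * eval c f) := by ring
    rw [h1]
    exact sub_mem (Ideal.mem_sup_right hfa) (Ideal.mem_sup_left hsub)
  have hpow : J ^ (j + 1) ≤ K * J ^ j := by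
    refine Submodule.le_of_le_smul_of_le_jacobson_bot (IsNoetherian.noetherian _)
      (jacobson_eq_maximalIdeal _ bot_ne_top).ge ?_
    refine (pow_succ_le_mul_pow_sup hJK ((Ideal.span_singleton_le_iff_mem _).2 hwJ) j).trans ?_
    refine sup_le le_sup_left ?_
    rw [Ideal.span_singleton_pow, Ideal.span_singleton_le_iff_mem]
    exact hwpow
  obtain ⟨hJI, m, hm⟩ := hJ.1
  have hred : IsReduction I K := by
    refine ⟨hKJ.trans hJI, m + j, le_antisymm ?_ ?_⟩
    · rw [add_assoc, IsReduction.pow_add_eq hm, IsReduction.pow_add_eq hm, ← mul_assoc]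
      exact Ideal.mul_mono_left hpow
    · rw [pow_succ']
      exact Ideal.mul_mono_left (hKJ.trans hJI)
  have hKeq : K = J := le_antisymm hKJ (hJ.2 hred hKJ)
  have hcard := hmin ((Finset.univ.erase p).image fun i => a i - c i * w) (by
    rw [← hKeq]
    apply le_antisymm
    · exact Ideal.span_mono (by simp)
    · rw [Ideal.span_le]
      rintro _ ⟨i, rfl⟩
      by_cases hi : i = p
      · have h0 : a i - c i * w = 0 := by rw [hi, ← hu, hw, sub_self]
        simp only [h0]
        exact zero_mem _
      · exact Ideal.subset_span (by
          simp only [Finset.coe_image, Finset.coe_erase]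
          exact ⟨i, by simpa using hi, rfl⟩))
  have h1 := hcard.trans Finset.card_image_le
  rw [Finset.card_erase_of_mem (Finset.mem_univ _), Finset.card_univ, Fintype.card_fin] at h1
  have := p.pos
  omega

end SallyModules

/-! ### Growth of the powers of an ideal and the number of independent generators -/

namespace SallyModules

open IsLocalRing MvPolynomial

theorem sum_multichoose (n N : ℕ) :
    ∑ i ∈ Finset.range (N + 1), n.multichoose i = (n + 1).multichoose N := by
  induction N with
  | zero => simp
  | succ N ih => rw [Finset.sum_range_succ, ih, Nat.multichoose_succ_succ, add_comm]

theorem multichoose_le_of_le {m n : ℕ} (h : m ≤ n) (N : ℕ) : m.multichoose N ≤ n.multichoose N := by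
  rw [Nat.multichoose_eq, Nat.multichoose_eq]
  exact Nat.choose_le_choose _ (by omega)

theorem exists_mul_multichoose_lt (C d : ℕ) :
    ∃ N, C * (d + 1).multichoose N < (d + 2).multichoose N := by
  -- The quotient of the two multichoose numbers is `(d + N + 1) / (d + 1)`, which exceeds `C` at
  -- this `N`.
  refine ⟨C * (d + 1), ?_⟩
  set N := C * (d + 1) with hN
  have h1 : (d + 1).multichoose N = (d + N).choose d := by
    rw [Nat.multichoose_eq, ← Nat.choose_symm_of_eq_add (a := d) (b := N)]
    · congr 1; omega
    · omega
  have h2 : (d + 2).multichoose N = (d + N + 1).choose (d + 1) := by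
    rw [Nat.multichoose_eq, ← Nat.choose_symm_of_eq_add (a := d + 1) (b := N)]
    · congr 1; omega
    · omega
  rw [h1, h2]
  have h3 := Nat.add_one_mul_choose_eq (d + N) d
  have h4 : 0 < (d + N).choose d := Nat.choose_pos (by omega)
  by_contra! hcon
  have h5 : (d + N + 1) * (d + N).choose d ≤ N * (d + N).choose d := by
    rw [h3]
    calc _ ≤ C * (d + N).choose d * (d + 1) := Nat.mul_le_mul_right _ hcon
      _ = N * (d + N).choose d := by rw [hN]; ring
  have h6 := Nat.le_of_mul_le_mul_right h5 h4
  omega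

variable {R : Type*} [CommRing R]

/-- The monomial of degree `n` in the elements of a family. -/
def familyMonomial {l : ℕ} (a : Fin l → R) {n : ℕ} (s : Sym (Fin l) n) : R :=
  ((s : Multiset (Fin l)).map a).prod

theorem familyMonomial_mem_pow {l : ℕ} {a : Fin l → R} {J : Ideal R} (ha : ∀ i, a i ∈ J) {n : ℕ}
    (s : Sym (Fin l) n) : familyMonomial a s ∈ J ^ n := by
  have h : ∀ s : Multiset (Fin l), (s.map a).prod ∈ J ^ s.card := by
    intro s
    induction s using Multiset.induction_on with
    | empty => simp
    | cons i s ih =>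
      rw [Multiset.map_cons, Multiset.prod_cons, Multiset.card_cons, pow_succ']
      exact Ideal.mul_mem_mul (ha i) ih
  have hs : (s : Multiset (Fin l)).card = n := s.2
  have := h s
  rwa [hs] at this

theorem pow_le_span_familyMonomial {l : ℕ} (a : Fin l → R) (n : ℕ) :
    Ideal.span (Set.range a) ^ n ≤
      Ideal.span (Set.range fun s : Sym (Fin l) n => familyMonomial a s) := by
  induction n with
  | zero =>
    have : (1 : R) ∈ Ideal.span (Set.range fun s : Sym (Fin l) 0 => familyMonomial a s) :=
      Ideal.subset_span ⟨Sym.nil, by simp [familyMonomial]⟩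
    rw [(Ideal.eq_top_iff_one _).2 this]
    exact le_top
  | succ n ih =>
    rw [pow_succ']
    refine (Ideal.mul_mono_right ih).trans ?_
    rw [Ideal.span_mul_span', Ideal.span_le]
    rintro _ ⟨_, ⟨i, rfl⟩, _, ⟨s, rfl⟩, rfl⟩
    exact Ideal.subset_span ⟨i ::ₛ s, by simp [familyMonomial, Sym.coe_cons]⟩

/-- The linear map from the free module on the monomials of degree `n`. -/
noncomputable def monomialMap {l : ℕ} (a : Fin l → R) (n : ℕ) (K : Ideal R) :
    (Sym (Fin l) n → R) →ₗ[R] R ⧸ K :=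
  K.mkQ ∘ₗ Fintype.linearCombination R (fun s : Sym (Fin l) n => familyMonomial a s)

theorem monomialMap_apply {l : ℕ} (a : Fin l → R) (n : ℕ) (K : Ideal R) (c : Sym (Fin l) n → R) :
    monomialMap a n K c = Submodule.Quotient.mk (∑ s, c s * familyMonomial a s) := by
  simp [monomialMap, Fintype.linearCombination_apply]

theorem length_quotient_pi {ι : Type*} [Fintype ι] [DecidableEq ι] (Q : Ideal R) :
    Module.length R ((ι → R) ⧸ Submodule.pi Set.univ fun _ : ι => Q) =
      Fintype.card ι * Module.length R (R ⧸ Q) := by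
  rw [(Submodule.quotientPi fun _ : ι => Q).length_eq]
  simp

theorem length_quotient_add_of_le {K L : Ideal R} (h : K ≤ L) :
    Module.length R (R ⧸ K) =
      Module.length R (LinearMap.ker (Submodule.factor h)) + Module.length R (R ⧸ L) :=
  Module.length_eq_add_of_exact (LinearMap.ker (Submodule.factor h)).subtype (Submodule.factor h)
    (Submodule.subtype_injective _) (Submodule.factor_surjective h)
    (LinearMap.exact_subtype_ker_map _)

/-- An upper bound for the growth of the powers of an ideal with `d` generators. -/
theorem length_quotient_pow_succ_le {d : ℕ} (q : Fin d → R) (n : ℕ) :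
    Module.length R (R ⧸ Ideal.span (Set.range q) ^ (n + 1)) ≤
      d.multichoose n * Module.length R (R ⧸ Ideal.span (Set.range q)) +
        Module.length R (R ⧸ Ideal.span (Set.range q) ^ n) := by
  classical
  set Q := Ideal.span (Set.range q) with hQ
  have hle : Q ^ (n + 1) ≤ Q ^ n := Ideal.pow_le_pow_right (Nat.le_succ n)
  rw [length_quotient_add_of_le hle]
  gcongr
  have hqQ : ∀ i, q i ∈ Q := fun i => Ideal.subset_span ⟨i, rfl⟩
  have hker : LinearMap.ker (Submodule.factor hle) ≤
      LinearMap.range (monomialMap q n (Q ^ (n + 1))) := by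
    intro x hx
    obtain ⟨x, rfl⟩ := Submodule.Quotient.mk_surjective _ x
    have hx' : x ∈ Q ^ n := by
      rw [LinearMap.mem_ker] at hx
      exact (Submodule.Quotient.mk_eq_zero _).1 hx
    obtain ⟨c, hc⟩ := (Submodule.mem_span_range_iff_exists_fun R).1
      (pow_le_span_familyMonomial q n hx')
    exact ⟨c, by rw [monomialMap_apply, ← hc]; simp⟩
  -- So `Q ^ n / Q ^ (n + 1)` is covered by one copy of `R ⧸ Q` for each monomial of degree `n`.
  have hpi : (Submodule.pi Set.univ fun _ : Sym (Fin d) n => Q) ≤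
      LinearMap.ker (monomialMap q n (Q ^ (n + 1))) := by
    intro c hc
    rw [LinearMap.mem_ker, monomialMap_apply, Submodule.Quotient.mk_eq_zero]
    refine Ideal.sum_mem _ fun s _ => ?_
    rw [pow_succ']
    exact Ideal.mul_mem_mul (hc s trivial) (familyMonomial_mem_pow hqQ s)
  calc Module.length R (LinearMap.ker (Submodule.factor hle))
      ≤ Module.length R (LinearMap.range (monomialMap q n (Q ^ (n + 1)))) :=
        Module.length_le_of_injective (Submodule.inclusion hker) (Submodule.inclusion_injective _)
    _ = Module.length R ((Sym (Fin d) n → R) ⧸ LinearMap.ker (monomialMap q n (Q ^ (n + 1)))) :=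
        (LinearMap.quotKerEquivRange _).length_eq.symm
    _ ≤ Module.length R ((Sym (Fin d) n → R) ⧸ Submodule.pi Set.univ fun _ => Q) :=
        Module.length_le_of_surjective (Submodule.factor hpi) (Submodule.factor_surjective hpi)
    _ = d.multichoose n * Module.length R (R ⧸ Q) := by
        rw [length_quotient_pi, Sym.card_sym_eq_multichoose, Fintype.card_fin]

/-- A lower bound for the growth of the powers of an ideal with analytically independent
generators. -/
theorem le_length_quotient_pow_succ [IsLocalRing R] {l : ℕ} {a : Fin l → R} {J : Ideal R}
    (haJ : ∀ i, a i ∈ J) (hJ : J ≤ maximalIdeal R)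
    (hind : ∀ (f : MvPolynomial (Fin l) R) (j : ℕ), f.IsHomogeneous j →
      eval a f ∈ maximalIdeal R * J ^ j → ∀ α, f.coeff α ∈ maximalIdeal R) (n : ℕ) :
    l.multichoose n + Module.length R (R ⧸ J ^ n) ≤ Module.length R (R ⧸ J ^ (n + 1)) := by
  classical
  -- It suffices to bound the length of `J ^ n / 𝔪 J ^ n`, a quotient of `J ^ n / J ^ (n + 1)` in
  -- which independence makes the monomials linearly independent over the residue field.
  set K := maximalIdeal R * J ^ n with hK
  have hKle : K ≤ J ^ n := Ideal.mul_le_right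
  have hleK : J ^ (n + 1) ≤ K := by
    rw [pow_succ']
    exact Ideal.mul_mono_left hJ
  refine le_trans ?_ (Module.length_le_of_surjective (Submodule.factor hleK)
    (Submodule.factor_surjective hleK))
  rw [length_quotient_add_of_le hKle]
  gcongr
  have hrange : LinearMap.range (monomialMap a n K) ≤ LinearMap.ker (Submodule.factor hKle) := by
    rintro _ ⟨c, rfl⟩
    rw [LinearMap.mem_ker, monomialMap_apply]
    refine (Submodule.Quotient.mk_eq_zero _).2 ?_
    exact Ideal.sum_mem _ fun s _ => Ideal.mul_mem_left _ _ (familyMonomial_mem_pow haJ s)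
  have hpi : LinearMap.ker (monomialMap a n K) ≤
      (Submodule.pi Set.univ fun _ : Sym (Fin l) n => maximalIdeal R) := by
    intro c hc
    rw [LinearMap.mem_ker, monomialMap_apply, Submodule.Quotient.mk_eq_zero] at hc
    intro s _
    let f : MvPolynomial (Fin l) R :=
      ∑ s : Sym (Fin l) n, monomial (Multiset.toFinsupp (s : Multiset (Fin l))) (c s)
    have hf : f.IsHomogeneous n := IsHomogeneous.sum _ _ _ fun s _ =>
      isHomogeneous_monomial _ (by
        have hs : (s : Multiset (Fin l)).card = n := s.2
        exact (Multiset.toFinsupp_sum_eq _).trans hs)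
    have hfa : eval a f = ∑ s, c s * familyMonomial a s := by
      simp only [f, map_sum, eval_monomial]
      refine Finset.sum_congr rfl fun s _ => ?_
      have h1 := prod_map_toMultiset a (Multiset.toFinsupp (s : Multiset (Fin l)))
      rw [Multiset.toFinsupp_toMultiset] at h1
      rw [familyMonomial, h1, Finsupp.prod_fintype _ _ (by simp)]
    have hcoeff : f.coeff (Multiset.toFinsupp (s : Multiset (Fin l))) = c s := by
      simp only [f, coeff_sum, coeff_monomial, EmbeddingLike.apply_eq_iff_eq, Sym.coe_inj]
      simp
    rw [← hcoeff]
    exact hind f n hf (hfa ▸ hc) _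
  have hres : Module.length R (R ⧸ maximalIdeal R) = 1 := by
    rw [Module.length_eq_one_iff, isSimpleModule_iff_isCoatom]
    exact Ideal.isMaximal_def.1 inferInstance
  calc (l.multichoose n : ℕ∞)
      = Module.length R ((Sym (Fin l) n → R) ⧸ Submodule.pi Set.univ fun _ => maximalIdeal R) := by
        rw [length_quotient_pi, Sym.card_sym_eq_multichoose, Fintype.card_fin, hres, mul_one]
    _ ≤ Module.length R ((Sym (Fin l) n → R) ⧸ LinearMap.ker (monomialMap a n K)) :=
        Module.length_le_of_surjective (Submodule.factor hpi) (Submodule.factor_surjective hpi)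
    _ = Module.length R (LinearMap.range (monomialMap a n K)) :=
        (LinearMap.quotKerEquivRange _).length_eq
    _ ≤ Module.length R (LinearMap.ker (Submodule.factor hKle)) :=
        Module.length_le_of_injective (Submodule.inclusion hrange)
          (Submodule.inclusion_injective _)

/-- The number of analytically independent generators is at most the number of elements of a
system of parameters. -/
theorem le_of_analyticallyIndependent [IsLocalRing R] [IsNoetherianRing R] {l d : ℕ}
    {a : Fin l → R} {J : Ideal R}
    (haJ : ∀ i, a i ∈ J) (hJ : J ≤ maximalIdeal R)
    (hind : ∀ (f : MvPolynomial (Fin l) R) (j : ℕ), f.IsHomogeneous j →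
      eval a f ∈ maximalIdeal R * J ^ j → ∀ α, f.coeff α ∈ maximalIdeal R)
    {q : Fin d → R} (hqJ : ∀ i, q i ∈ J)
    (hq : maximalIdeal R ∈ (Ideal.span (Set.range q)).minimalPrimes) : l ≤ d := by
  set Q := Ideal.span (Set.range q) with hQ
  have hfin : Module.length R (R ⧸ Q) ≠ ⊤ := by
    have := quotient_artinian_of_mem_minimalPrimes_of_isLocalRing Q hq
    rw [Module.length_eq_of_surjective (R := R ⧸ Q) Ideal.Quotient.mk_surjective]
    exact Module.length_ne_top
  obtain ⟨C, hC⟩ := ENat.ne_top_iff_exists.1 hfin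
  have hupper : ∀ n, Module.length R (R ⧸ Q ^ n) ≤
      ((C * ∑ i ∈ Finset.range n, d.multichoose i : ℕ) : ℕ∞) := by
    intro n
    induction n with
    | zero => simp [Ideal.one_eq_top, Submodule.Quotient.subsingleton_iff]
    | succ n ih =>
      refine (length_quotient_pow_succ_le q n).trans ?_
      rw [← hQ, ← hC, Finset.sum_range_succ, mul_add, add_comm]
      push_cast at ih ⊢
      rw [mul_comm (C : ℕ∞) (d.multichoose n : ℕ∞)]
      gcongr
  have hlower : ∀ n, ((∑ i ∈ Finset.range n, l.multichoose i : ℕ) : ℕ∞) ≤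
      Module.length R (R ⧸ J ^ n) := by
    intro n
    induction n with
    | zero => simp
    | succ n ih =>
      refine le_trans ?_ (le_length_quotient_pow_succ haJ hJ hind n)
      rw [Finset.sum_range_succ, add_comm]
      push_cast at ih ⊢
      gcongr
  -- If `l > d`, the lower bound `(l + 1).multichoose N` outgrows the upper bound `C * (d +
  -- 1).multichoose N`.
  by_contra! hlt
  obtain ⟨N, hN⟩ := exists_mul_multichoose_lt C d
  have hle : Q ^ (N + 1) ≤ J ^ (N + 1) := Ideal.pow_right_mono (Ideal.span_le.2 (by
    rintro _ ⟨i, rfl⟩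
    exact hqJ i)) _
  have h1 := (hlower (N + 1)).trans ((Module.length_le_of_surjective (Submodule.factor hle)
    (Submodule.factor_surjective hle)).trans (hupper (N + 1)))
  have h2 := Nat.cast_le.1 h1
  rw [sum_multichoose, sum_multichoose] at h2
  have h3 := multichoose_le_of_le (m := d + 2) (n := l + 1) (by omega) N
  omega

end SallyModules

/-! ### Cohen-Macaulay local rings and generators of a minimal reduction -/

namespace SallyModules

open IsLocalRing RingTheory.Sequence

theorem exists_isWeaklyRegular_of_le_localDepth {A : Type*} [CommRing A] [IsLocalRing A] {n : ℕ}
    (h : (n : ℕ∞) ≤ localDepth A) :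
    ∃ xs : List A, xs.length = n ∧ IsWeaklyRegular A xs ∧ ∀ x ∈ xs, x ∈ maximalIdeal A := by
  rcases Nat.eq_zero_or_pos n with rfl | hn
  · exact ⟨[], rfl, .nil A A, by simp⟩
  obtain ⟨xs, hxs, hxm, hlen⟩ : ∃ xs : List A, IsRegular A xs ∧ (∀ x ∈ xs, x ∈ maximalIdeal A) ∧
      n ≤ xs.length := by
    by_contra! hcon
    have : localDepth A ≤ ((n - 1 : ℕ) : ℕ∞) := by
      refine iSup_le fun xs => iSup_le fun hxs => iSup_le fun hxm => ?_
      have := hcon xs hxs hxm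
      exact_mod_cast (by omega : xs.length ≤ n - 1)
    have h2 : n ≤ n - 1 := by exact_mod_cast h.trans this
    omega
  refine ⟨xs.take n, by simpa using hlen, ?_, fun x hx => hxm x (List.mem_of_mem_take hx)⟩
  have := hxs.toIsWeaklyRegular
  rw [← List.take_append_drop n xs, isWeaklyRegular_append_iff] at this
  exact this.1

theorem length_le_localDepth {A : Type*} [CommRing A] [IsLocalRing A] [IsNoetherianRing A]
    {xs : List A} (h : IsWeaklyRegular A xs) (hxm : ∀ x ∈ xs, x ∈ maximalIdeal A) :
    (xs.length : ℕ∞) ≤ localDepth A :=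
  le_iSup_of_le xs (le_iSup_of_le (IsRegular.of_isWeaklyRegular_of_mem_maximalIdeal A hxm h)
    (le_iSup_of_le hxm le_rfl))

theorem localDepth_le_ringKrullDim {A : Type*} [CommRing A] [IsLocalRing A] [IsNoetherianRing A] :
    (localDepth A : WithBot ℕ∞) ≤ ringKrullDim A := by
  rw [← maximalIdeal_height_eq_ringKrullDim]
  refine WithBot.coe_le_coe.2 (iSup_le fun xs => iSup_le fun hxs => iSup_le fun hxm => ?_)
  have h1 := ringKrullDim_add_length_eq_ringKrullDim_of_isRegular xs hxs
  have : Nontrivial (A ⧸ Ideal.ofList xs) := Ideal.Quotient.nontrivial_iff.2 fun h =>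
    hxs.top_ne_smul (by rw [h]; simp)
  have h4 : (0 : WithBot ℕ∞) ≤ ringKrullDim (A ⧸ Ideal.ofList xs) :=
    ringKrullDim_nonneg_of_nontrivial
  apply WithBot.coe_le_coe.1
  rw [maximalIdeal_height_eq_ringKrullDim, ← h1]
  exact le_add_of_nonneg_left h4

theorem ofList_ofFn {A : Type*} [CommRing A] {d : ℕ} (s : Fin d → A) :
    Ideal.ofList (List.ofFn s) = Ideal.span (Set.range s) := by
  unfold Ideal.ofList
  congr 1
  ext x
  simp [List.mem_ofFn]

/-- In a Cohen-Macaulay local ring of dimension `d`, any `d` elements generating an ideal primary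
to the maximal ideal are a regular sequence. -/
theorem IsCohenMacaulayLocalRing.regularFamily {A : Type*} [CommRing A] [IsLocalRing A]
    (hA : IsCohenMacaulayLocalRing A) {d : ℕ} (hd : (d : WithBot ℕ∞) ≤ ringKrullDim A)
    {s : Fin d → A} (hsm : ∀ i, s i ∈ maximalIdeal A)
    (hs : ∀ p : Ideal A, p.IsPrime → (∀ i, s i ∈ p) → p = maximalIdeal A) : RegularFamily s := by
  have := hA.isNoetherianRing
  obtain ⟨xs, hlen, hxs, hxm⟩ := exists_isWeaklyRegular_of_le_localDepth (A := A) (n := d) (by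
    rw [← hA.depth_eq_dim] at hd
    exact WithBot.coe_le_coe.1 hd)
  rw [← isWeaklyRegular_ofFn_iff]
  refine isWeaklyRegular_of_length_eq xs _ hxs hxm (by simp [hlen]) ?_ fun p hp hle => hs p hp ?_
  · simpa [List.mem_ofFn] using hsm
  · rw [ofList_ofFn, Ideal.span_le] at hle
    exact fun i => hle ⟨i, rfl⟩

section Reduction

variable {R : Type*} [CommRing R] [IsLocalRing R] {I J : Ideal R}

theorem eq_maximalIdeal_of_isReduction (hI : I.radical = maximalIdeal R) (hJ : IsReduction I J)
    {p : Ideal R} (hp : p.IsPrime) (hle : J ≤ p) : p = maximalIdeal R := by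
  obtain ⟨_, m, hm⟩ := hJ
  refine le_antisymm (le_maximalIdeal hp.ne_top) ?_
  rw [← hI, hp.radical_le_iff]
  exact hp.le_of_pow_le (hm.trans_le (Ideal.mul_le_left.trans hle))

/-- A generating family of least size is analytically independent, so it has at most `dim R`
members, while Krull's height theorem gives at least `dim R`. It is thus a system of parameters,
hence regular. -/
theorem exists_generators_of_isMinimalReduction (hCM : IsCohenMacaulayLocalRing R)
    [Infinite (ResidueField R)] (hI : I.radical = maximalIdeal R) (hJ : IsMinimalReduction I J) :
    ∃ (d : ℕ) (a : Fin d → R), ringKrullDim R = d ∧ Ideal.span (Set.range a) = J ∧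
      RegularFamily a ∧
      ∀ (f : MvPolynomial (Fin d) R) (j : ℕ), f.IsHomogeneous j →
        MvPolynomial.eval a f ∈ maximalIdeal R * J ^ j → ∀ α, f.coeff α ∈ maximalIdeal R := by
  classical
  have := hCM.isNoetherianRing
  have hprime : ∀ p : Ideal R, p.IsPrime → J ≤ p → p = maximalIdeal R := fun p hp hle =>
    eq_maximalIdeal_of_isReduction hI hJ.1 hp hle
  have hIm : I ≤ maximalIdeal R := hI ▸ Ideal.le_radical
  have hJm : J ≤ maximalIdeal R := hJ.1.1.trans hIm
  have hex : ∃ n, ∃ s : Finset R, s.card = n ∧ Ideal.span (s : Set R) = J := by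
    obtain ⟨s, hs⟩ := IsNoetherian.noetherian J
    exact ⟨_, s, rfl, hs⟩
  obtain ⟨s, hcard, hs⟩ := Nat.find_spec hex
  set l := Nat.find hex with hl
  have hmin : ∀ s : Finset R, Ideal.span (s : Set R) = J → l ≤ s.card :=
    fun s hs => Nat.find_min' hex ⟨s, rfl, hs⟩
  let a : Fin l → R := fun i => s.equivFinOfCardEq hcard |>.symm i
  have ha : Ideal.span (Set.range a) = J := by
    rw [← hs]
    congr 1
    ext x
    constructor
    · rintro ⟨i, rfl⟩
      exact Subtype.coe_prop _
    · intro hx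
      exact ⟨s.equivFinOfCardEq hcard ⟨x, hx⟩, by simp [a]⟩
  have haJ : ∀ i, a i ∈ J := fun i => ha ▸ Ideal.subset_span ⟨i, rfl⟩
  have hind := fun (f : MvPolynomial (Fin l) R) (j : ℕ) (hf : f.IsHomogeneous j) hfa =>
    hJ.coeff_mem_maximalIdeal ha hmin hf hfa
  obtain ⟨t, ht, htcard⟩ := Ideal.exists_finset_card_eq_height_of_isNoetherianRing (maximalIdeal R)
  have hmemJ : ∀ x ∈ maximalIdeal R, ∃ n, 0 < n ∧ x ^ n ∈ J := by
    intro x hx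
    have : x ∈ J.radical := by
      rw [Ideal.radical_eq_sInf, Ideal.mem_sInf]
      rintro p ⟨hle, hp⟩
      rwa [hprime p hp hle]
    obtain ⟨n, hn⟩ := this
    exact ⟨n + 1, n.succ_pos, by rw [pow_succ]; exact Ideal.mul_mem_right _ _ hn⟩
  have htm : ∀ x ∈ t, x ∈ maximalIdeal R := fun x hx => ht.1.2 (Ideal.subset_span hx)
  let q₀ : Fin t.card → R := fun i => t.equivFin.symm i
  -- Powers of a system of parameters are again parameters and can be taken inside `J`, where the
  -- growth of `J` can be compared with theirs.
  choose c hc hcJ using fun i => hmemJ (q₀ i) (htm _ (Subtype.coe_prop _))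
  have hq : maximalIdeal R ∈ (Ideal.span (Set.range fun i => q₀ i ^ c i)).minimalPrimes := by
    refine ⟨⟨inferInstance, Ideal.span_le.2 ?_⟩, fun p hp hpm => ?_⟩
    · rintro _ ⟨i, rfl⟩
      exact hJm (hcJ i)
    · refine ht.2 ⟨hp.1, Ideal.span_le.2 fun x hx => ?_⟩ hpm
      have h1 : x = q₀ (t.equivFin ⟨x, hx⟩) := by simp [q₀]
      rw [h1]
      exact hp.1.mem_of_pow_mem _ (hp.2 (Ideal.subset_span ⟨_, rfl⟩))
  have hle : l ≤ t.card := le_of_analyticallyIndependent haJ hJm hind hcJ hq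
  have hge : t.card ≤ l := by
    have h1 : maximalIdeal R ∈ (Ideal.span (s : Set R)).minimalPrimes := by
      rw [hs]
      exact ⟨⟨inferInstance, hJm⟩, fun p hp _ => (hprime p hp.1 hp.2).ge⟩
    have h2 := Ideal.height_le_card_of_mem_minimalPrimes_span_finset h1
    rw [← htcard, hcard] at h2
    exact_mod_cast h2
  have hdim : ringKrullDim R = l := by
    rw [← maximalIdeal_height_eq_ringKrullDim, ← htcard, le_antisymm hge hle]
    rfl
  refine ⟨l, a, hdim, ha, hCM.regularFamily hdim.ge (fun i => hJm (haJ i)) fun p hp hap => ?_, hind⟩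
  refine hprime p hp ?_
  rw [← ha, Ideal.span_le]
  rintro _ ⟨i, rfl⟩
  exact hap i

end Reduction

end SallyModules

/-! ### The grading of the associated graded ring and its degree one forms -/

namespace SallyModules

open DirectSum

section AssociatedGraded

variable {R : Type*} [CommRing R] {I : Ideal R} {A : Type*} [CommRing A] [Algebra R A]

/-- A presentation of an algebra as the associated graded ring of `I`, by a surjective map from the
Rees algebra with kernel `I R[It]`. -/
structure IsAssociatedGraded (π : reesAlgebra I →ₐ[R] A) : Prop where
  surjective : Function.Surjective π
  eq_zero_iff : ∀ f : reesAlgebra I, π f = 0 ↔ ∀ i, (f : Polynomial R).coeff i ∈ I ^ (i + 1)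

/-- The class in `Iᵏ/Iᵏ⁺¹ ⊆ gr_I(R)` of an element of `Iᵏ`. -/
noncomputable def initialForm (π : reesAlgebra I →ₐ[R] A) (k : ℕ) : ↥(I ^ k) →ₗ[R] A where
  toFun b := π ⟨Polynomial.monomial k (b : R), reesAlgebra.monomial_mem.2 b.2⟩
  map_add' b c := by
    rw [← map_add]
    congr 1
    exact Subtype.ext (by simp)
  map_smul' r b := by
    rw [RingHom.id_apply, ← map_smul]
    congr 1
    exact Subtype.ext (by simp [Polynomial.smul_monomial])

variable {π : reesAlgebra I →ₐ[R] A} (hπ : IsAssociatedGraded π)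

include hπ in
theorem IsAssociatedGraded.eq_iff (f g : reesAlgebra I) :
    π f = π g ↔ ∀ i, (f : Polynomial R).coeff i - (g : Polynomial R).coeff i ∈ I ^ (i + 1) := by
  rw [← sub_eq_zero, ← map_sub, hπ.eq_zero_iff]
  exact forall_congr' fun i => by
    rw [AddSubgroupClass.coe_sub, Polynomial.coeff_sub]

include hπ in
theorem initialForm_eq_zero_iff {k : ℕ} (b : ↥(I ^ k)) :
    initialForm π k b = 0 ↔ (b : R) ∈ I ^ (k + 1) := by
  refine (hπ.eq_zero_iff _).trans ⟨fun h => by simpa using h k, fun h i => ?_⟩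
  simp only [Polynomial.coeff_monomial]
  split_ifs with hi
  · exact hi ▸ h
  · exact zero_mem _

include hπ in
theorem initialForm_eq_iff {k : ℕ} (b c : ↥(I ^ k)) :
    initialForm π k b = initialForm π k c ↔ (b : R) - c ∈ I ^ (k + 1) := by
  rw [← sub_eq_zero, ← map_sub, initialForm_eq_zero_iff hπ, AddSubgroupClass.coe_sub]

theorem initialForm_mul {k l : ℕ} (b : ↥(I ^ k)) (c : ↥(I ^ l)) :
    initialForm π k b * initialForm π l c =
      initialForm π (k + l) ⟨b * c, by rw [pow_add]; exact Ideal.mul_mem_mul b.2 c.2⟩ := by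
  change π _ * π _ = π _
  rw [← map_mul]
  congr 1
  exact Subtype.ext (by simp [Polynomial.monomial_mul_monomial])

theorem algebraMap_eq_initialForm (π : reesAlgebra I →ₐ[R] A) (r : R) :
    algebraMap R A r = initialForm π 0 ⟨r, by simp⟩ := by
  rw [← π.commutes]
  change π _ = π _
  congr 1

theorem map_eq_sum_initialForm (f : reesAlgebra I) :
    π f = ∑ i ∈ (f : Polynomial R).support, initialForm π i ⟨(f : Polynomial R).coeff i, f.2 i⟩ := by
  change _ = ∑ i ∈ (f : Polynomial R).support, π _
  rw [← map_sum]
  congr 1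
  apply Subtype.ext
  rw [AddSubmonoidClass.coe_finsetSum]
  exact (f : Polynomial R).as_sum_support

/-- The homogeneous components of the associated graded ring. -/
noncomputable def gradedPiece (π : reesAlgebra I →ₐ[R] A) (k : ℕ) : Submodule R A :=
  LinearMap.range (initialForm π k)

theorem initialForm_mem {k : ℕ} (b : ↥(I ^ k)) : initialForm π k b ∈ gradedPiece π k := ⟨b, rfl⟩

-- Uniqueness of homogeneous components: lift `x` coefficientwise to the Rees algebra and compare it
-- with `f` modulo the kernel of `π`. This makes the sum direct and computes the projections.
include hπ in
theorem initialForm_coeff_eq_of_map_eq_coe (f : reesAlgebra I) (x : ⨁ i, gradedPiece π i)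
    (h : π f = DirectSum.coeAddMonoidHom (gradedPiece π) x) (k : ℕ) :
    initialForm π k ⟨(f : Polynomial R).coeff k, f.2 k⟩ = x k := by
  classical
  choose b hb using fun i => (x i).2
  let g : reesAlgebra I := ∑ i ∈ DFinsupp.support x,
    ⟨Polynomial.monomial i (b i : R), reesAlgebra.monomial_mem.2 (b i).2⟩
  have hg : π g = DirectSum.coeAddMonoidHom (gradedPiece π) x := by
    rw [DirectSum.coeAddMonoidHom_eq_dfinsuppSum, DFinsupp.sum, map_sum]
    exact Finset.sum_congr rfl fun i _ => hb i
  have hcoeff : (g : Polynomial R).coeff k = if k ∈ DFinsupp.support x then (b k : R) else 0 := by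
    simp only [g, AddSubmonoidClass.coe_finsetSum, Polynomial.finsetSum_coeff,
      Polynomial.coeff_monomial]
    simp
  have h1 := (hπ.eq_iff f g).1 (h.trans hg.symm) k
  rw [hcoeff] at h1
  split_ifs at h1 with hk
  · rw [← hb k]
    exact (initialForm_eq_iff hπ _ _).2 h1
  · rw [DFinsupp.notMem_support_iff.1 hk]
    refine (initialForm_eq_zero_iff hπ _).2 ?_
    simpa using h1

/-- The grading of the associated graded ring. -/
@[reducible]
noncomputable def IsAssociatedGraded.gradedAlgebra (hπ : IsAssociatedGraded π) :
    GradedAlgebra (gradedPiece π) where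
  one_mem := ⟨⟨1, by simp⟩, (algebraMap_eq_initialForm π 1).symm.trans (map_one _)⟩
  mul_mem := by
    rintro i j _ _ ⟨b, rfl⟩ ⟨c, rfl⟩
    rw [initialForm_mul]
    exact initialForm_mem _
  -- The components are read off an arbitrary preimage in the Rees algebra; their independence of
  -- that choice is `initialForm_coeff_eq_of_map_eq_coe`.
  decompose' x := ∑ i ∈ (hπ.surjective x).choose.1.support,
    DirectSum.of (fun i => gradedPiece π i) i
      ⟨initialForm π i ⟨(hπ.surjective x).choose.1.coeff i,
        (hπ.surjective x).choose.2 i⟩, initialForm_mem _⟩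
  left_inv x := by
    rw [map_sum]
    simp only [DirectSum.coeAddMonoidHom_of]
    rw [← map_eq_sum_initialForm]
    exact (hπ.surjective x).choose_spec
  right_inv x := by
    classical
    ext k
    set y := DirectSum.coeAddMonoidHom (gradedPiece π) x
    rw [← initialForm_coeff_eq_of_map_eq_coe hπ _ x (hπ.surjective y).choose_spec k,
      DirectSum.sum_apply, AddSubmonoidClass.coe_finsetSum]
    by_cases hk : k ∈ (hπ.surjective y).choose.1.support
    · rw [Finset.sum_eq_single_of_mem k hk, DirectSum.of_eq_same]
      intro j _ hj
      rw [DirectSum.of_eq_of_ne _ _ _ hj.symm]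
      rfl
    · rw [Finset.sum_eq_zero]
      · symm
        rw [initialForm_eq_zero_iff hπ]
        rw [Polynomial.notMem_support_iff] at hk
        simp only [hk]
        exact zero_mem _
      · intro j hj
        rw [DirectSum.of_eq_of_ne _ _ _ (by rintro rfl; exact hk hj)]
        rfl

/-- An element of a product ideal `(s_j : j ∈ t) L` as a combination with coefficients in `L`. -/
theorem exists_of_mem_span_image_mul {d : ℕ} (s : Fin d → R) (t : Set (Fin d)) (L : Ideal R)
    {x : R} (hx : x ∈ Ideal.span (s '' t) * L) :
    ∃ c : Fin d → R, (∀ j, j ∉ t → c j = 0) ∧ (∀ j, c j ∈ L) ∧ x = ∑ j, s j * c j := by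
  induction hx using Submodule.mul_induction_on' with
  | mem_mul_mem m hm n hn =>
    obtain ⟨c, hc, rfl⟩ := (mem_span_image_iff_exists s t m).1 hm
    refine ⟨fun j => c j * n, fun j hj => by simp [hc j hj], fun j => Ideal.mul_mem_left _ _ hn, ?_⟩
    rw [Finset.sum_mul]
    exact Finset.sum_congr rfl fun j _ => mul_assoc _ _ _
  | add x _ y _ hx hy =>
    obtain ⟨c, hc, hcL, rfl⟩ := hx
    obtain ⟨c', hc', hcL', rfl⟩ := hy
    exact ⟨c + c', fun j hj => by simp [hc j hj, hc' j hj], fun j => add_mem (hcL j) (hcL' j), by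
      simp [mul_add, Finset.sum_add_distrib]⟩

variable {d : ℕ}

/-- The initial forms in degree one of a family of elements of `I`. -/
noncomputable def linearForms (π : reesAlgebra I →ₐ[R] A) {a : Fin d → R} (ha : ∀ i, a i ∈ I)
    (i : Fin d) : A :=
  initialForm π 1 ⟨a i, by simpa using ha i⟩

variable {a : Fin d → R} (ha : ∀ i, a i ∈ I)

theorem linearForms_mem (i : Fin d) : linearForms π ha i ∈ gradedPiece π 1 := initialForm_mem _

theorem mul_mem_pow_succ_of_mem {I : Ideal R} {x b : R} {k : ℕ} (hx : x ∈ I) (hb : b ∈ I ^ k) :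
    x * b ∈ I ^ (k + 1) := by
  rw [pow_succ']
  exact Ideal.mul_mem_mul hx hb

theorem linearForms_mul_initialForm (i : Fin d) {k : ℕ} (b : ↥(I ^ k)) :
    linearForms π ha i * initialForm π k b =
      initialForm π (k + 1) ⟨a i * b, mul_mem_pow_succ_of_mem (ha i) b.2⟩ := by
  rw [linearForms, initialForm_mul]
  have : ∀ (l : ℕ) (h : 1 + k = l) (x : R) (hx : x ∈ I ^ (1 + k)),
      initialForm π (1 + k) ⟨x, hx⟩ = initialForm π l ⟨x, h ▸ hx⟩ := by
    rintro l rfl x hx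
    rfl
  exact this _ (add_comm 1 k) _ _

variable [GradedAlgebra (gradedPiece π)]

include hπ in
theorem proj_map (f : reesAlgebra I) (k : ℕ) :
    GradedRing.proj (gradedPiece π) k (π f) =
      initialForm π k ⟨(f : Polynomial R).coeff k, f.2 k⟩ := by
  rw [GradedRing.proj_apply, initialForm_coeff_eq_of_map_eq_coe hπ f
    (decompose (gradedPiece π) (π f))]
  exact ((decompose (gradedPiece π)).left_inv _).symm

include hπ in
theorem exists_proj_eq_initialForm (x : A) (k : ℕ) :
    ∃ b : ↥(I ^ k), GradedRing.proj (gradedPiece π) k x = initialForm π k b := by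
  obtain ⟨f, rfl⟩ := hπ.surjective x
  exact ⟨_, proj_map hπ f k⟩

-- The component in degree `k + 1` of a combination of degree one forms only involves the degree `k`
-- parts of the coefficients, and these lift to `I ^ k`.
include hπ in
theorem mem_of_initialForm_mem_span {S : Set (Fin d)} {k : ℕ} {b : ↥(I ^ (k + 1))}
    (h : initialForm π (k + 1) b ∈ Ideal.span (linearForms π ha '' S)) :
    (b : R) ∈ Ideal.span (a '' S) * I ^ k ⊔ I ^ (k + 2) := by
  classical
  obtain ⟨c, hc, hbc⟩ := (mem_span_image_iff_exists (linearForms π ha) S _).1 h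
  choose b' hb' using fun j => exists_proj_eq_initialForm hπ (c j) k
  let u : Fin d → ↥(I ^ (k + 1)) := fun j =>
    if j ∈ S then ⟨a j * b' j, mul_mem_pow_succ_of_mem (ha j) (b' j).2⟩ else 0
  have h1 : initialForm π (k + 1) b = initialForm π (k + 1) (∑ j, u j) := by
    have h2 : GradedRing.proj (gradedPiece π) (k + 1) (initialForm π (k + 1) b) =
        initialForm π (k + 1) b := by
      rw [GradedRing.proj_apply, decompose_of_mem_same _ (initialForm_mem b)]
    rw [← h2, hbc, map_sum, map_sum]
    refine Finset.sum_congr rfl fun j _ => ?_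
    by_cases hj : j ∈ S
    · simp only [u, if_pos hj]
      rw [← linearForms_mul_initialForm, ← hb']
      exact proj_mul_of_left_mem (linearForms_mem ha j) _ (Nat.le_add_left 1 k)
    · simp only [u, if_neg hj, hc j hj, mul_zero, map_zero]
  rw [initialForm_eq_iff hπ] at h1
  rw [← sub_add_cancel (b : R) ((∑ j, u j : ↥(I ^ (k + 1))) : R)]
  refine add_mem (Ideal.mem_sup_right h1) (Ideal.mem_sup_left ?_)
  rw [AddSubmonoidClass.coe_finsetSum]
  refine Ideal.sum_mem _ fun j _ => ?_
  by_cases hj : j ∈ S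
  · simp only [u, if_pos hj]
    exact Ideal.mul_mem_mul (Ideal.subset_span ⟨j, hj, rfl⟩) (b' j).2
  · simp only [u, if_neg hj]
    exact zero_mem _

omit [GradedAlgebra (gradedPiece π)] in
include hπ in
theorem initialForm_mem_span_of_mem {S : Set (Fin d)} {k : ℕ} {b : ↥(I ^ (k + 1))}
    (h : (b : R) ∈ Ideal.span (a '' S) * I ^ k ⊔ I ^ (k + 2)) :
    initialForm π (k + 1) b ∈ Ideal.span (linearForms π ha '' S) := by
  obtain ⟨u, hu, w, hw, huw⟩ := Submodule.mem_sup.1 h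
  obtain ⟨c, hc, hcI, rfl⟩ := exists_of_mem_span_image_mul a S _ hu
  have h1 : initialForm π (k + 1) b = ∑ j, linearForms π ha j * initialForm π k ⟨c j, hcI j⟩ := by
    simp_rw [linearForms_mul_initialForm]
    rw [← map_sum, initialForm_eq_iff hπ, AddSubmonoidClass.coe_finsetSum, ← huw]
    simpa using hw
  rw [h1]
  refine Ideal.sum_mem _ fun j _ => ?_
  by_cases hj : j ∈ S
  · exact Ideal.mul_mem_right _ _ (Ideal.subset_span ⟨j, hj, rfl⟩)
  · have h3 : initialForm π k ⟨c j, hcI j⟩ = 0 := by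
      rw [initialForm_eq_zero_iff hπ]
      simp [hc j hj]
    rw [h3, mul_zero]
    exact zero_mem _

include hπ in
theorem initialForm_zero_mem_span_iff (S : Set (Fin d)) (b : ↥(I ^ 0)) :
    initialForm π 0 b ∈ Ideal.span (linearForms π ha '' S) ↔ (b : R) ∈ I := by
  have h0 : initialForm π 0 b = 0 ↔ (b : R) ∈ I := by
    rw [initialForm_eq_zero_iff hπ, zero_add, pow_one]
  refine ⟨fun h => ?_, fun h => h0.2 h ▸ zero_mem _⟩
  obtain ⟨c, hc, hbc⟩ := (mem_span_image_iff_exists (linearForms π ha) S _).1 h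
  have h2 : GradedRing.proj (gradedPiece π) 0 (initialForm π 0 b) = initialForm π 0 b := by
    rw [GradedRing.proj_apply, decompose_of_mem_same _ (initialForm_mem b)]
  rw [← h0, ← h2, hbc, map_sum]
  refine Finset.sum_eq_zero fun j _ => ?_
  rw [GradedRing.proj_apply,
    coe_decompose_mul_of_left_mem_of_not_le _ (linearForms_mem ha j) (by simp)]

-- The truncated exponent is correct in degree zero: for `k = 0` the right-hand ideal is `(a_S) + I
-- = I`, and a span of degree one forms contains no nonzero element of degree zero.
include hπ in
theorem initialForm_mem_span_linearForms_iff (S : Set (Fin d)) {k : ℕ} (b : ↥(I ^ k)) :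
    initialForm π k b ∈ Ideal.span (linearForms π ha '' S) ↔
      (b : R) ∈ Ideal.span (a '' S) * I ^ (k - 1) ⊔ I ^ (k + 1) := by
  cases k with
  | zero =>
    have hle : Ideal.span (a '' S) ≤ I := by
      rw [Ideal.span_le]
      rintro _ ⟨j, _, rfl⟩
      exact ha j
    have h1 : Ideal.span (a '' S) * I ^ (0 - 1) ⊔ I ^ (0 + 1) = I := by
      rw [Nat.zero_sub, pow_zero, mul_one, zero_add, pow_one, sup_eq_right.2 hle]
    rw [initialForm_zero_mem_span_iff hπ, h1]
  | succ k => exact ⟨mem_of_initialForm_mem_span hπ ha, initialForm_mem_span_of_mem hπ ha⟩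

include hπ in
/-- Regularity of the sequence of initial forms, in terms of elements of the ring. -/
theorem regularFamily_linearForms_iff :
    RegularFamily (linearForms π ha) ↔ InitialFormsRegular I a := by
  classical
  constructor
  · intro h i k b hb hab
    have h1 : initialForm π (k + 1) ⟨a i * b, mul_mem_pow_succ_of_mem (ha i) hb⟩ ∈
        Ideal.span (linearForms π ha '' Set.Iio i) :=
      (initialForm_mem_span_linearForms_iff hπ ha _ _).2 hab
    rw [← linearForms_mul_initialForm ha i ⟨b, hb⟩] at h1
    exact (initialForm_mem_span_linearForms_iff hπ ha _ ⟨b, hb⟩).1 (h i _ h1)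
  · intro h i x hx
    have hhom : (Ideal.span (linearForms π ha '' Set.Iio i)).IsHomogeneous (gradedPiece π) := by
      apply Ideal.homogeneous_span
      rintro _ ⟨j, _, rfl⟩
      exact ⟨1, linearForms_mem ha j⟩
    rw [← sum_support_decompose (gradedPiece π) x]
    refine Ideal.sum_mem _ fun k _ => ?_
    have h1 := hhom (1 + k) hx
    rw [coe_decompose_mul_of_left_mem_of_le _ (linearForms_mem ha i) (Nat.le_add_right _ _),
      Nat.add_sub_cancel_left] at h1
    obtain ⟨b, hb⟩ := exists_proj_eq_initialForm hπ x k
    rw [GradedRing.proj_apply] at hb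
    rw [hb, linearForms_mul_initialForm, initialForm_mem_span_linearForms_iff hπ] at h1
    rw [hb, initialForm_mem_span_linearForms_iff hπ]
    exact h i k b b.2 h1

end AssociatedGraded

end SallyModules

/-! ### Integrality over the degree one forms, and primes of the graded ring -/

namespace SallyModules

open DirectSum IsLocalRing

section AssociatedGraded

variable {R : Type*} [CommRing R] {I : Ideal R} {A : Type*} [CommRing A] [Algebra R A]
  {π : reesAlgebra I →ₐ[R] A} {d : ℕ} {a : Fin d → R} (ha : ∀ i, a i ∈ I) {m : ℕ}

theorem IsReduction.pow_succ_eq {J : Ideal R} (hm : I ^ (m + 1) = J * I ^ m) {k : ℕ}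
    (hk : m ≤ k) : I ^ (k + 1) = J * I ^ k := by
  obtain ⟨i, rfl⟩ := Nat.exists_eq_add_of_le hk
  rw [add_assoc, IsReduction.pow_add_eq hm, IsReduction.pow_add_eq hm, ← mul_assoc, ← pow_succ']

theorem initialForm_succ_eq_sum (hm : I ^ (m + 1) = Ideal.span (Set.range a) * I ^ m) {k : ℕ}
    (hk : m ≤ k) (b : ↥(I ^ (k + 1))) :
    ∃ c : Fin d → ↥(I ^ k), initialForm π (k + 1) b =
      ∑ j, linearForms π ha j * initialForm π k (c j) := by
  have hb : (b : R) ∈ Ideal.span (a '' Set.univ) * I ^ k := by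
    rw [Set.image_univ, ← IsReduction.pow_succ_eq hm hk]
    exact b.2
  obtain ⟨c, _, hcI, hbc⟩ := exists_of_mem_span_image_mul a Set.univ _ hb
  refine ⟨fun j => ⟨c j, hcI j⟩, ?_⟩
  simp_rw [linearForms_mul_initialForm]
  rw [← map_sum]
  congr 1
  apply Subtype.ext
  rw [AddSubmonoidClass.coe_finsetSum, hbc]

/-- The associated graded ring is integral over the subalgebra generated by the initial forms of
generators of a reduction. -/
theorem isIntegral_aeval_linearForms [IsNoetherianRing R] (hπ : IsAssociatedGraded π)
    (hm : I ^ (m + 1) = Ideal.span (Set.range a) * I ^ m) :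
    (MvPolynomial.aeval (R := R) (linearForms π ha)).toRingHom.IsIntegral := by
  let φ := MvPolynomial.aeval (R := R) (linearForms π ha)
  let _ : Algebra (MvPolynomial (Fin d) R) A := φ.toRingHom.toAlgebra
  have htower : IsScalarTower R (MvPolynomial (Fin d) R) A :=
    IsScalarTower.of_algebraMap_eq fun r => (φ.commutes r).symm
  have hX : ∀ (j : Fin d) (x : A),
      (MvPolynomial.X j : MvPolynomial (Fin d) R) • x = linearForms π ha j * x := fun j x => by
    rw [Algebra.smul_def]
    congr 1
    exact MvPolynomial.aeval_X _ _
  -- The pieces of degree at most `m` generate everything, since beyond degree `m` each form is a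
  -- combination of the linear forms.
  let L : Submodule R A := ⨆ i ∈ Finset.range (m + 1), gradedPiece π i
  have hL : L.FG := Submodule.fg_biSup _ _ fun i _ => by
    rw [gradedPiece, LinearMap.range_eq_map]
    exact (Module.Finite.fg_top).map _
  let N : Submodule (MvPolynomial (Fin d) R) A := Submodule.span _ (L : Set A)
  have hN : ∀ k, ∀ b : ↥(I ^ k), initialForm π k b ∈ N := by
    intro k
    induction k with
    | zero =>
      exact fun b => Submodule.subset_span
        (Submodule.mem_iSup_of_mem 0 (Submodule.mem_iSup_of_mem (by simp) (initialForm_mem b)))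
    | succ k ih =>
      intro b
      rcases le_or_gt (k + 1) m with hk | hk
      · exact Submodule.subset_span (Submodule.mem_iSup_of_mem (k + 1)
          (Submodule.mem_iSup_of_mem (Finset.mem_range.2 (by omega)) (initialForm_mem b)))
      · obtain ⟨c, hc⟩ := initialForm_succ_eq_sum (π := π) ha hm (by omega) b
        rw [hc]
        refine Submodule.sum_mem _ fun j _ => ?_
        rw [← hX]
        exact N.smul_mem _ (ih (c j))
  have htop : N = ⊤ := by
    rw [eq_top_iff]
    rintro x -
    obtain ⟨f, rfl⟩ := hπ.surjective x
    rw [map_eq_sum_initialForm]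
    exact Submodule.sum_mem _ fun i _ => hN i _
  have hfin : Module.Finite (MvPolynomial (Fin d) R) A := by
    refine ⟨?_⟩
    rw [← htop]
    obtain ⟨s, hs⟩ := hL
    refine ⟨s, ?_⟩
    simp only [N]
    rw [← hs, Submodule.span_span_of_tower]
  exact fun x => Algebra.IsIntegral.isIntegral (R := MvPolynomial (Fin d) R) x

section Local

variable [IsLocalRing R] (hI : I.radical = maximalIdeal R)

-- Elements of `I` vanish in the degree zero part `R ⧸ I`, so every prime contracts to a prime
-- containing `I`.
include hI in
theorem comap_algebraMap_eq_maximalIdeal (hπ : IsAssociatedGraded π) (p : Ideal A)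
    [hp : p.IsPrime] : p.comap (algebraMap R A) = maximalIdeal R := by
  have hp' : (p.comap (algebraMap R A)).IsPrime := inferInstance
  refine le_antisymm (le_maximalIdeal hp'.ne_top) ?_
  rw [← hI, hp'.radical_le_iff]
  intro r hr
  rw [Ideal.mem_comap, algebraMap_eq_initialForm π, (initialForm_eq_zero_iff hπ _).2 (by simpa)]
  exact zero_mem _

include hI in
/-- A prime of the associated graded ring which contains monic polynomials in the initial forms of
generators of a reduction is maximal. -/
theorem isMaximal_of_monic_mem [IsNoetherianRing R] (hπ : IsAssociatedGraded π)
    (hm : I ^ (m + 1) = Ideal.span (Set.range a) * I ^ m) {F : Fin d → Polynomial R}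
    (hF : ∀ i, (F i).Monic) (p : Ideal A) [hp : p.IsPrime]
    (hFp : ∀ i, Polynomial.aeval (linearForms π ha i) (F i) ∈ p) : p.IsMaximal := by
  let q : A →ₐ[R] A ⧸ p := Ideal.Quotient.mkₐ R p
  let φ := MvPolynomial.aeval (R := R) (linearForms π ha)
  have hint : ∀ i, IsIntegral R (q (linearForms π ha i)) := fun i => by
    refine ⟨F i, hF i, ?_⟩
    rw [← Polynomial.aeval_def, Polynomial.aeval_algHom_apply]
    exact Ideal.Quotient.eq_zero_iff_mem.2 (hFp i)
  have hφ : ∀ s, q (φ s) ∈ integralClosure R (A ⧸ p) := by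
    intro s
    induction s using MvPolynomial.induction_on with
    | C r =>
      have : q (φ (MvPolynomial.C r)) = algebraMap R _ r := by
        rw [← MvPolynomial.algebraMap_eq, AlgHom.commutes, AlgHom.commutes]
      rw [this]
      exact Subalgebra.algebraMap_mem _ r
    | add s t hs ht =>
      rw [map_add, map_add]
      exact add_mem hs ht
    | mul_X s i hs =>
      rw [map_mul, map_mul]
      refine mul_mem hs ?_
      simp only [φ, MvPolynomial.aeval_X]
      exact hint i
  have hall : Algebra.IsIntegral R (A ⧸ p) := by
    refine ⟨fun x => ?_⟩
    obtain ⟨x, rfl⟩ := Ideal.Quotient.mk_surjective x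
    obtain ⟨f, hf, hfx⟩ := isIntegral_aeval_linearForms ha hπ hm x
    let ψ : MvPolynomial (Fin d) R →+* integralClosure R (A ⧸ p) :=
      (q.comp φ).toRingHom.codRestrict _ hφ
    have h1 : IsIntegral (integralClosure R (A ⧸ p)) (Ideal.Quotient.mk p x) := by
      refine ⟨f.map ψ, hf.map _, ?_⟩
      rw [Polynomial.eval₂_map]
      have h2 : (algebraMap (integralClosure R (A ⧸ p)) (A ⧸ p)).comp ψ =
          (Ideal.Quotient.mk p).comp φ.toRingHom := rfl
      rw [h2, ← Polynomial.hom_eval₂, hfx, map_zero]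
    exact isIntegral_trans _ h1
  -- The domain `A ⧸ p` is integral over `R`, and its zero ideal contracts to the maximal ideal, so
  -- it is a field.
  have hbot : (⊥ : Ideal (A ⧸ p)).IsMaximal := by
    refine Ideal.isMaximal_of_isIntegral_of_isMaximal_comap (R := R) _ ?_
    have : (⊥ : Ideal (A ⧸ p)).comap (algebraMap R (A ⧸ p)) = p.comap (algebraMap R A) := by
      ext r
      rw [Ideal.mem_comap, Ideal.mem_bot, Ideal.mem_comap, ← Ideal.Quotient.eq_zero_iff_mem]
      rfl
    rw [this, comap_algebraMap_eq_maximalIdeal hI hπ p]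
    infer_instance
  exact Ideal.bot_quotient_isMaximal_iff p |>.1 hbot

variable [GradedAlgebra (gradedPiece π)]

-- The power `x ^ (m + 1)` has degree above `m`, where every form is a combination of the linear
-- forms; primality brings `x` itself into `p`.
omit [IsLocalRing R] in
theorem mem_of_linearForms_mem (hm : I ^ (m + 1) = Ideal.span (Set.range a) * I ^ m) {p : Ideal A}
    [hp : p.IsPrime] (hap : ∀ i, linearForms π ha i ∈ p) {k : ℕ} (hk : 0 < k) {x : A}
    (hx : x ∈ gradedPiece π k) : x ∈ p := by
  have hlarge : ∀ k, m ≤ k → ∀ x ∈ gradedPiece π (k + 1), x ∈ p := by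
    rintro k hk _ ⟨b, rfl⟩
    obtain ⟨c, hc⟩ := initialForm_succ_eq_sum (π := π) ha hm hk b
    rw [hc]
    exact Ideal.sum_mem _ fun j _ => Ideal.mul_mem_right _ _ (hap j)
  have h1 : x ^ (m + 1) ∈ gradedPiece π ((m + 1) * k) := by
    simpa using SetLike.pow_mem_graded (m + 1) hx
  obtain ⟨k', hk'⟩ : ∃ k', (m + 1) * k = k' + 1 :=
    Nat.exists_eq_succ_of_ne_zero (Nat.mul_pos (Nat.succ_pos m) hk).ne'
  rw [hk'] at h1
  exact hp.mem_of_pow_mem _ (hlarge k' (by nlinarith) _ h1)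

omit [IsLocalRing R] in
theorem mem_iff_proj_zero_mem (hm : I ^ (m + 1) = Ideal.span (Set.range a) * I ^ m) {p : Ideal A}
    [hp : p.IsPrime] (hap : ∀ i, linearForms π ha i ∈ p) (x : A) :
    x ∈ p ↔ GradedRing.proj (gradedPiece π) 0 x ∈ p := by
  classical
  have h : x - GradedRing.proj (gradedPiece π) 0 x ∈ p := by
    have h0 : GradedRing.proj (gradedPiece π) 0 (x - GradedRing.proj (gradedPiece π) 0 x) = 0 := by
      rw [map_sub]
      simp [GradedRing.proj_apply]
    rw [← sum_support_decompose (gradedPiece π) (x - GradedRing.proj (gradedPiece π) 0 x)]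
    refine Ideal.sum_mem _ fun k _ => ?_
    rcases Nat.eq_zero_or_pos k with rfl | hk
    · rw [GradedRing.proj_apply] at h0
      rw [h0]
      exact zero_mem _
    · exact mem_of_linearForms_mem ha hm hap hk (SetLike.coe_mem _)
  exact ⟨fun hx => by simpa using sub_mem hx h, fun hx => by simpa using add_mem h hx⟩

include hI in
theorem isUnit_proj_zero (hπ : IsAssociatedGraded π)
    (hm : I ^ (m + 1) = Ideal.span (Set.range a) * I ^ m) {p : Ideal A} [hp : p.IsPrime]
    (hap : ∀ i, linearForms π ha i ∈ p) (x : A) (hx : x ∉ p) :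
    IsUnit (GradedRing.proj (gradedPiece π) 0 x) := by
  rw [mem_iff_proj_zero_mem ha hm hap] at hx
  obtain ⟨b, hb⟩ := exists_proj_eq_initialForm hπ x 0
  have h1 : initialForm π 0 b = algebraMap R A b := (algebraMap_eq_initialForm π _).symm
  rw [hb, h1, ← Ideal.mem_comap, comap_algebraMap_eq_maximalIdeal hI hπ, notMem_maximalIdeal] at hx
  rw [hb, h1]
  exact hx.map _

end Local

end AssociatedGraded

end SallyModules

/-! ### A prime of height at least `d` containing the degree one forms -/

namespace SallyModules

open IsLocalRing

section PolynomialMap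

variable {R : Type*} [CommRing R] {I : Ideal R} {A : Type*} [CommRing A] [Algebra R A]
  {π : reesAlgebra I →ₐ[R] A} {d : ℕ} {a : Fin d → R} (ha : ∀ i, a i ∈ I) {m : ℕ}

theorem aeval_C_mul_X_coeff (a : Fin d → R) (f : MvPolynomial (Fin d) R) (k : ℕ) :
    (MvPolynomial.aeval (fun i => Polynomial.C (a i) * Polynomial.X) f).coeff k =
      MvPolynomial.eval a (f.homogeneousComponent k) := by
  have hhom : ∀ (j : ℕ) (g : MvPolynomial (Fin d) R), g.IsHomogeneous j →
      MvPolynomial.aeval (fun i => Polynomial.C (a i) * Polynomial.X) g =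
        Polynomial.monomial j (MvPolynomial.eval a g) := by
    intro j g hg
    rw [MvPolynomial.aeval_def, MvPolynomial.eval₂_eq_eval_map,
      eval_mul_of_isHomogeneous (hg.map _), MvPolynomial.eval_map, Polynomial.algebraMap_eq,
      ← Polynomial.C_mul_X_pow_eq_monomial, MvPolynomial.eval₂_comp, mul_comm]
    rfl
  conv_lhs => rw [← MvPolynomial.sum_homogeneousComponent f]
  rw [map_sum, Polynomial.finsetSum_coeff]
  simp_rw [hhom _ _ (MvPolynomial.homogeneousComponent_isHomogeneous _ f),
    Polynomial.coeff_monomial]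
  rw [Finset.sum_ite_eq']
  split_ifs with hk
  · rfl
  · rw [MvPolynomial.homogeneousComponent_eq_zero, map_zero]
    simpa using hk

theorem aeval_linearForms_eq_zero_iff (hπ : IsAssociatedGraded π) (f : MvPolynomial (Fin d) R) :
    MvPolynomial.aeval (linearForms π ha) f = 0 ↔
      ∀ k, MvPolynomial.eval a (f.homogeneousComponent k) ∈ I ^ (k + 1) := by
  let t : Fin d → reesAlgebra I := fun i =>
    ⟨Polynomial.monomial 1 (a i), reesAlgebra.monomial_mem.2 (by simpa using ha i)⟩
  have h1 : MvPolynomial.aeval (linearForms π ha) f = π (MvPolynomial.aeval t f) := by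
    rw [MvPolynomial.comp_aeval_apply]
    rfl
  have h2 : ((MvPolynomial.aeval t f : reesAlgebra I) : Polynomial R) =
      MvPolynomial.aeval (fun i => Polynomial.C (a i) * Polynomial.X) f := by
    change (reesAlgebra I).val _ = _
    rw [MvPolynomial.comp_aeval_apply]
    congr 2
    ext1 i
    exact Polynomial.C_mul_X_eq_monomial.symm
  rw [h1, hπ.eq_zero_iff]
  exact forall_congr' fun k => by rw [h2, aeval_C_mul_X_coeff]

variable [IsLocalRing R]

theorem map_residue_eq_zero_iff {σ : Type*} (f : MvPolynomial σ R) :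
    MvPolynomial.map (residue R) f = 0 ↔ ∀ α, f.coeff α ∈ maximalIdeal R := by
  simp [MvPolynomial.ext_iff, MvPolynomial.coeff_map, residue_eq_zero_iff]

/-- A relation gives only `f_k(a) ∈ I ^ (k + 1)` for each homogeneous part. Raising to the power `m
+ 1` turns powers of `I` into powers of `J` with one factor to spare, so independence applies to
`f_k ^ (m + 1)`; polynomials over a field have no nilpotents. -/
theorem map_residue_eq_zero_of_aeval_linearForms_eq_zero {J : Ideal R} (hJ : J ≤ maximalIdeal R)
    (hm : I ^ (m + 1) = J * I ^ m)
    (hind : ∀ (f : MvPolynomial (Fin d) R) (j : ℕ), f.IsHomogeneous j →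
      MvPolynomial.eval a f ∈ maximalIdeal R * J ^ j → ∀ α, f.coeff α ∈ maximalIdeal R)
    (hπ : IsAssociatedGraded π) {f : MvPolynomial (Fin d) R}
    (hf : MvPolynomial.aeval (linearForms π ha) f = 0) :
    MvPolynomial.map (residue R) f = 0 := by
  rw [aeval_linearForms_eq_zero_iff ha hπ] at hf
  have key : ∀ k, MvPolynomial.map (residue R) (f.homogeneousComponent k) = 0 := by
    intro k
    have h1 : MvPolynomial.eval a (f.homogeneousComponent k ^ (m + 1)) ∈
        maximalIdeal R * J ^ (k * (m + 1)) := by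
      have h2 : (I ^ (k + 1)) ^ (m + 1) ≤ maximalIdeal R * J ^ (k * (m + 1)) := by
        rw [← pow_mul, show (k + 1) * (m + 1) = m + (k * (m + 1) + 1) by ring,
          IsReduction.pow_add_eq hm, pow_succ']
        exact Ideal.mul_le_left.trans (Ideal.mul_mono_left hJ)
      rw [map_pow]
      exact h2 (Ideal.pow_mem_pow (hf k) _)
    have h3 := hind _ _ ((MvPolynomial.homogeneousComponent_isHomogeneous k f).pow (m + 1)) h1
    rw [← map_residue_eq_zero_iff, map_pow] at h3
    exact pow_eq_zero_iff (Nat.succ_ne_zero m) |>.1 h3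
  rw [← MvPolynomial.sum_homogeneousComponent f, map_sum]
  exact Finset.sum_eq_zero fun k _ => key k

/-- The reduction modulo the maximal ideal and the first `i` variables. -/
noncomputable def residueKill (R : Type*) [CommRing R] [IsLocalRing R] (d i : ℕ) :
    MvPolynomial (Fin d) R →+* MvPolynomial (Fin d) (ResidueField R) :=
  MvPolynomial.eval₂Hom (MvPolynomial.C.comp (residue R))
    fun j => if (j : ℕ) < i then 0 else MvPolynomial.X j

theorem residueKill_zero : residueKill R d 0 = MvPolynomial.map (residue R) := by
  ext <;> simp [residueKill]

theorem ker_residueKill_lt_succ {i : ℕ} (hi : i < d) :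
    RingHom.ker (residueKill R d i) < RingHom.ker (residueKill R d (i + 1)) := by
  refine lt_of_le_not_ge (fun f hf => ?_) fun h => ?_
  · let θ : MvPolynomial (Fin d) (ResidueField R) →+* MvPolynomial (Fin d) (ResidueField R) :=
      MvPolynomial.eval₂Hom MvPolynomial.C fun j => if (j : ℕ) < i + 1 then 0 else MvPolynomial.X j
    have hθ : residueKill R d (i + 1) = θ.comp (residueKill R d i) := by
      refine MvPolynomial.ringHom_ext (fun r => ?_) fun j => ?_
      · simp [residueKill, θ]
      · simp only [residueKill, θ, RingHom.comp_apply, MvPolynomial.eval₂Hom_X']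
        by_cases hj : (j : ℕ) < i
        · simp [hj, Nat.lt_succ_of_lt hj]
        · simp [hj]
    rw [RingHom.mem_ker] at hf ⊢
    rw [hθ, RingHom.comp_apply, hf, map_zero]
  · have h1 : (MvPolynomial.X ⟨i, hi⟩ : MvPolynomial (Fin d) R) ∈
        RingHom.ker (residueKill R d (i + 1)) := by
      simp [RingHom.mem_ker, residueKill]
    have h2 := h h1
    simp [RingHom.mem_ker, residueKill] at h2

/-- Every relation among the forms has its coefficients in the maximal ideal, so the chain of primes
generated by `𝔪` and the first `i` variables lies over the kernel and lifts to `A` by integrality.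
The lifted chain has length `d` and its top contains every form. -/
theorem exists_isPrime_le_height [IsNoetherianRing R] {J : Ideal R} (hJ : J ≤ maximalIdeal R)
    (haJ : Ideal.span (Set.range a) = J) (hm : I ^ (m + 1) = J * I ^ m)
    (hind : ∀ (f : MvPolynomial (Fin d) R) (j : ℕ), f.IsHomogeneous j →
      MvPolynomial.eval a f ∈ maximalIdeal R * J ^ j → ∀ α, f.coeff α ∈ maximalIdeal R)
    (hπ : IsAssociatedGraded π) :
    ∃ P : Ideal A, P.IsPrime ∧ (∀ i, linearForms π ha i ∈ P) ∧ (d : ℕ∞) ≤ P.height := by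
  let φ := MvPolynomial.aeval (R := R) (linearForms π ha)
  let _ : Algebra (MvPolynomial (Fin d) R) A := φ.toRingHom.toAlgebra
  have hint : Algebra.IsIntegral (MvPolynomial (Fin d) R) A :=
    ⟨isIntegral_aeval_linearForms ha hπ (haJ ▸ hm)⟩
  have hprime : ∀ i, (RingHom.ker (residueKill R d i)).IsPrime := fun i => RingHom.ker_isPrime _
  have key : ∀ i ≤ d, ∃ P : Ideal A, P.IsPrime ∧
      P.comap (algebraMap (MvPolynomial (Fin d) R) A) = RingHom.ker (residueKill R d i) ∧
      (i : ℕ∞) ≤ P.height := by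
    intro i
    induction i with
    | zero =>
      intro _
      obtain ⟨P, _, hP, hPc⟩ := Ideal.exists_ideal_over_prime_of_isIntegral
        (RingHom.ker (residueKill R d 0)) (⊥ : Ideal A) (fun f hf => by
          rw [RingHom.mem_ker, residueKill_zero]
          exact map_residue_eq_zero_of_aeval_linearForms_eq_zero ha hJ hm hind hπ hf)
      exact ⟨P, hP, hPc, by simp⟩
    | succ i ih =>
      intro hi
      obtain ⟨P, hP, hPc, hPh⟩ := ih (by omega)
      have hlt := ker_residueKill_lt_succ (R := R) (d := d) (i := i) (by omega)
      obtain ⟨Q, hQ, hQp, hQc⟩ := Ideal.exists_ideal_over_prime_of_isIntegral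
        (RingHom.ker (residueKill R d (i + 1))) P (hPc.trans_le hlt.le)
      refine ⟨Q, hQp, hQc, ?_⟩
      have hPQ : P < Q := lt_of_le_of_ne hQ (by
        rintro rfl
        exact hlt.ne (hPc.symm.trans hQc))
      have := Ideal.height_add_one_le_of_lt_of_isPrime hPQ
      push_cast
      exact (add_le_add_left hPh 1).trans this
  obtain ⟨P, hP, hPc, hPh⟩ := key d le_rfl
  refine ⟨P, hP, fun i => ?_, hPh⟩
  have h1 : (MvPolynomial.X i : MvPolynomial (Fin d) R) ∈
      P.comap (algebraMap (MvPolynomial (Fin d) R) A) := by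
    rw [hPc]
    simp [RingHom.mem_ker, residueKill]
  have h2 : φ (MvPolynomial.X i) ∈ P := h1
  rwa [MvPolynomial.aeval_X] at h2

end PolynomialMap

end SallyModules

/-! ### Cohen-Macaulayness of the graded ring through the degree one forms -/

namespace SallyModules

open IsLocalRing RingTheory.Sequence

section CohenMacaulay

theorem eq_maximalIdeal_of_isMaximal_comap {A : Type*} [CommRing A] {P : Ideal A} [P.IsPrime]
    {p : Ideal (Localization.AtPrime P)} (hp : p ≠ ⊤)
    (h : (p.comap (algebraMap A (Localization.AtPrime P))).IsMaximal) : p = maximalIdeal _ := by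
  have h1 : p.comap (algebraMap A (Localization.AtPrime P)) ≤ P :=
    (Ideal.comap_mono (le_maximalIdeal hp)).trans_eq Localization.AtPrime.under_maximalIdeal
  have h2 := h.eq_of_le (Ideal.IsPrime.ne_top inferInstance) h1
  rw [← Localization.AtPrime.map_eq_maximalIdeal,
    ← IsLocalization.map_under P.primeCompl (Localization.AtPrime P) p]
  exact congrArg _ h2

/-- Zariski's lemma: `A ⧸ P` is a finitely generated algebra over the residue field of `R`, hence
finite, so the class of `x` is integral over `R`. -/
theorem exists_monic_aeval_mem {R A : Type*} [CommRing R] [IsLocalRing R] [CommRing A]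
    [Algebra R A] [Algebra.FiniteType R A] (P : Ideal A) [P.IsMaximal]
    (hP : P.comap (algebraMap R A) = maximalIdeal R) (x : A) :
    ∃ F : Polynomial R, F.Monic ∧ Polynomial.aeval x F ∈ P := by
  let K := R ⧸ maximalIdeal R
  let _ : Field (A ⧸ P) := Ideal.Quotient.field P
  let _ : Field K := Ideal.Quotient.field _
  let ψ : K →ₐ[R] A ⧸ P := Ideal.Quotient.liftₐ _ (Algebra.ofId R (A ⧸ P)) fun r hr => by
    rw [← hP, Ideal.mem_comap] at hr
    exact Ideal.Quotient.eq_zero_iff_mem.2 hr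
  let _ : Algebra K (A ⧸ P) := ψ.toRingHom.toAlgebra
  have : IsScalarTower R K (A ⧸ P) := IsScalarTower.of_algebraMap_eq fun r => (ψ.commutes r).symm
  have hft : Algebra.FiniteType R (A ⧸ P) :=
    Algebra.FiniteType.of_surjective (Ideal.Quotient.mkₐ R P) Ideal.Quotient.mk_surjective
  have : Algebra.FiniteType K (A ⧸ P) := Algebra.FiniteType.of_restrictScalars_finiteType R K _
  have : Module.Finite K (A ⧸ P) := finite_of_finite_type_of_isJacobsonRing K (A ⧸ P)
  have : Module.Finite R (A ⧸ P) := Module.Finite.trans K _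
  obtain ⟨F, hF, hFx⟩ := Algebra.IsIntegral.isIntegral (R := R) (Ideal.Quotient.mkₐ R P x)
  refine ⟨F, hF, ?_⟩
  rw [← Polynomial.aeval_def, Polynomial.aeval_algHom_apply] at hFx
  exact Ideal.Quotient.eq_zero_iff_mem.1 hFx

theorem RegularFamily.localization {A : Type*} [CommRing A] {d : ℕ} {s : Fin d → A}
    (hs : RegularFamily s) (P : Ideal A) [P.IsPrime] :
    RegularFamily fun i => algebraMap A (Localization.AtPrime P) (s i) := by
  rw [← isWeaklyRegular_ofFn_iff] at hs ⊢
  have := hs.of_isLocalization (Localization.AtPrime P) P.primeCompl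
  rwa [List.map_ofFn] at this

theorem aeval_sub_pow_mem_degreeLT {R A : Type*} [CommRing R] [CommRing A] [Algebra R A]
    (𝒜 : ℕ → Submodule R A) [GradedAlgebra 𝒜] {F : Polynomial R} (hF : F.Monic) {x : A}
    (hx : x ∈ 𝒜 1) : Polynomial.aeval x F - x ^ F.natDegree ∈ degreeLT 𝒜 F.natDegree := by
  have hpow : ∀ k, x ^ k ∈ 𝒜 k := fun k => by simpa using SetLike.pow_mem_graded k hx
  have hsum := congrArg (Polynomial.aeval x) hF.as_sum
  rw [map_add, map_sum, map_pow, Polynomial.aeval_X] at hsum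
  rw [hsum, add_sub_cancel_left]
  refine Submodule.sum_mem _ fun k hk => ?_
  rw [map_mul, map_pow, Polynomial.aeval_X, Polynomial.aeval_C, ← Algebra.smul_def]
  exact Submodule.smul_mem _ _ (mem_degreeLT_of_mem (Finset.mem_range.1 hk) (hpow k))

variable {R : Type*} [CommRing R] [IsLocalRing R] [IsNoetherianRing R] {I J : Ideal R}
  {A : Type*} [CommRing A] [Algebra R A] {π : reesAlgebra I →ₐ[R] A} (hπ : IsAssociatedGraded π)
  {d : ℕ} {a : Fin d → R} (ha : ∀ i, a i ∈ I) {m : ℕ} (hI : I.radical = maximalIdeal R)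
  (hm : I ^ (m + 1) = Ideal.span (Set.range a) * I ^ m)

include hπ hI hm

theorem isMaximal_of_linearForms_mem {p : Ideal A} [p.IsPrime]
    (hap : ∀ i, linearForms π ha i ∈ p) : p.IsMaximal :=
  isMaximal_of_monic_mem (F := fun _ => Polynomial.X) ha hI hπ hm (fun _ => Polynomial.monic_X) p
    fun i => by simpa using hap i

omit [IsNoetherianRing R] in
theorem regularFamily_linearForms_of_localization {P : Ideal A} [P.IsPrime]
    (hP : ∀ i, linearForms π ha i ∈ P)
    (hreg : RegularFamily fun i => algebraMap A (Localization.AtPrime P) (linearForms π ha i)) :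
    RegularFamily (linearForms π ha) := by
  let _ := hπ.gradedAlgebra
  exact regularFamily_of_localization (e := fun _ => 1) (linearForms_mem ha) P
    (isUnit_proj_zero ha hI hπ hm hP) hreg

theorem regularFamily_linearForms_of_isCohenMacaulayRing (hA : IsCohenMacaulayRing A)
    {P : Ideal A} [P.IsPrime] (hP : ∀ i, linearForms π ha i ∈ P) (hPd : (d : ℕ∞) ≤ P.height) :
    RegularFamily (linearForms π ha) := by
  have hmax : P.IsMaximal := isMaximal_of_linearForms_mem hπ ha hI hm hP
  refine regularFamily_linearForms_of_localization hπ ha hI hm hP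
    ((hA.localization P).regularFamily ?_ (fun i => ?_) fun p hp hap => ?_)
  · rw [IsLocalization.AtPrime.ringKrullDim_eq_height P]
    exact_mod_cast hPd
  · exact (IsLocalization.AtPrime.to_map_mem_maximal_iff _ P _).2 (hP i)
  · exact eq_maximalIdeal_of_isMaximal_comap hp.ne_top
      (isMaximal_of_linearForms_mem hπ ha hI hm hap)

/-- After localizing at `P` the powers still generate an ideal primary to the maximal ideal, with
the same number of elements as a known regular sequence; homogeneity brings regularity back to `A`.
-/
theorem regularFamily_linearForms_pow {P : Ideal A} [P.IsPrime]
    (hP : ∀ i, linearForms π ha i ∈ P) (hreg : RegularFamily (linearForms π ha)) {e : Fin d → ℕ}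
    (he : ∀ i, e i ≠ 0) : RegularFamily fun i => linearForms π ha i ^ e i := by
  let _ := hπ.gradedAlgebra
  have : IsNoetherianRing A := isNoetherianRing_of_surjective _ _ π.toRingHom hπ.surjective
  have hpow : ∀ i, linearForms π ha i ^ e i ∈ gradedPiece π (e i) := fun i => by
    simpa using SetLike.pow_mem_graded (e i) (linearForms_mem (π := π) ha i)
  refine regularFamily_of_localization hpow P (isUnit_proj_zero ha hI hπ hm hP) ?_
  rw [← isWeaklyRegular_ofFn_iff]
  have hmem : ∀ i, algebraMap A (Localization.AtPrime P) (linearForms π ha i) ∈ maximalIdeal _ :=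
    fun i => (IsLocalization.AtPrime.to_map_mem_maximal_iff _ P _).2 (hP i)
  refine isWeaklyRegular_of_length_eq _ _ ((isWeaklyRegular_ofFn_iff _).2 (hreg.localization P))
    ?_ (by simp) ?_ fun p hp hap => ?_
  · simpa [List.mem_ofFn] using hmem
  · simp only [List.mem_ofFn]
    rintro _ ⟨i, rfl⟩
    rw [map_pow]
    exact Ideal.pow_mem_of_mem _ (hmem i) _ (Nat.pos_of_ne_zero (he i))
  · refine eq_maximalIdeal_of_isMaximal_comap hp.ne_top
      (isMaximal_of_linearForms_mem hπ ha hI hm fun i => ?_)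
    rw [ofList_ofFn] at hap
    have h1 : algebraMap A _ (linearForms π ha i ^ e i) ∈ p := hap (Ideal.subset_span ⟨i, rfl⟩)
    rw [map_pow] at h1
    exact hp.mem_of_pow_mem _ h1

/-- An arbitrary maximal ideal `P` need not contain the forms, so they are replaced by monic
polynomials in them that lie in `P`. These give depth at least `d`, and Krull's theorem gives height
at most `d`. -/
theorem isCohenMacaulayRing_of_regularFamily_linearForms {M : Ideal A} [M.IsPrime]
    (hM : ∀ i, linearForms π ha i ∈ M) (hreg : RegularFamily (linearForms π ha)) :
    IsCohenMacaulayRing A := by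
  classical
  let _ := hπ.gradedAlgebra
  have hN : IsNoetherianRing A := isNoetherianRing_of_surjective _ _ π.toRingHom hπ.surjective
  have hft : Algebra.FiniteType R A := Algebra.FiniteType.of_surjective π hπ.surjective
  refine ⟨hN, fun P hP => ?_⟩
  have hNP : IsNoetherianRing (Localization.AtPrime P) :=
    IsLocalization.isNoetherianRing P.primeCompl _ hN
  refine ⟨hNP, le_antisymm localDepth_le_ringKrullDim ?_⟩
  choose F hF hFP using fun i =>
    exists_monic_aeval_mem P (comap_algebraMap_eq_maximalIdeal hI hπ P) (linearForms π ha i)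
  have hdeg : ∀ i, (F i).natDegree ≠ 0 := fun i h0 => by
    have h1 := hFP i
    rw [(hF i).natDegree_eq_zero.1 h0, map_one] at h1
    exact hP.ne_top ((Ideal.eq_top_iff_one P).2 h1)
  let s : Fin d → A := fun i => Polynomial.aeval (linearForms π ha i) (F i)
  have hs : RegularFamily s := regularFamily_of_topForm (𝒜 := gradedPiece π)
    (fun i => by simpa using SetLike.pow_mem_graded (F i).natDegree (linearForms_mem (π := π) ha i))
    (fun i => aeval_sub_pow_mem_degreeLT _ (hF i) (linearForms_mem ha i))
    (regularFamily_linearForms_pow hπ ha hI hm hM hreg hdeg)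
  have hdepth := length_le_localDepth ((isWeaklyRegular_ofFn_iff _).2 (hs.localization P)) (by
    simp only [List.mem_ofFn]
    rintro _ ⟨i, rfl⟩
    exact (IsLocalization.AtPrime.to_map_mem_maximal_iff _ P _).2 (hFP i))
  rw [List.length_ofFn] at hdepth
  have hmin : P ∈ (Ideal.span (Set.range s)).minimalPrimes := by
    refine ⟨⟨inferInstance, ?_⟩, fun p hp hpP => ?_⟩
    · rw [Ideal.span_le]
      rintro _ ⟨i, rfl⟩
      exact hFP i
    · have := hp.1
      have hpm : p.IsMaximal := isMaximal_of_monic_mem ha hI hπ hm hF p fun i =>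
        hp.2 (Ideal.subset_span ⟨i, rfl⟩)
      exact (hpm.eq_of_le hP.ne_top hpP).ge
  have hheight : P.height ≤ d := by
    refine (Ideal.height_le_card_of_mem_minimalPrimes_span (Set.finite_range s) hmin).trans ?_
    have : (Set.range s).ncard ≤ d := by
      rw [← Set.image_univ]
      exact (Set.ncard_image_le).trans (by simp)
    exact_mod_cast this
  rw [IsLocalization.AtPrime.ringKrullDim_eq_height P]
  exact_mod_cast hheight.trans hdepth

end CohenMacaulay

/-- The associated graded ring of an `𝔪`-primary ideal is Cohen-Macaulay if and only if a minimal
reduction satisfies the Valabrega-Valla equalities. -/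
theorem isCohenMacaulayRing_iff_inf_pow_le {R : Type*} [CommRing R] [IsLocalRing R]
    [Infinite (ResidueField R)] (hCM : IsCohenMacaulayLocalRing R) {I J : Ideal R}
    (hI : I.radical = maximalIdeal R) (hJ : IsMinimalReduction I J) {A : Type*} [CommRing A]
    [Algebra R A] {π : reesAlgebra I →ₐ[R] A} (hπ : IsAssociatedGraded π) :
    IsCohenMacaulayRing A ↔ ∀ k, J ⊓ I ^ k ≤ J * I ^ (k - 1) := by
  have := hCM.isNoetherianRing
  obtain ⟨d, a, -, rfl, hreg, hind⟩ := exists_generators_of_isMinimalReduction hCM hI hJ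
  obtain ⟨hJI, m, hm⟩ := hJ.1
  have ha : ∀ i, a i ∈ I := fun i => hJI (Ideal.subset_span ⟨i, rfl⟩)
  have hJm : Ideal.span (Set.range a) ≤ maximalIdeal R := hJI.trans (hI ▸ Ideal.le_radical)
  obtain ⟨P, hP, haP, hPd⟩ := exists_isPrime_le_height ha hJm rfl hm hind hπ
  let _ := hπ.gradedAlgebra
  constructor
  · intro hA
    exact InitialFormsRegular.inf_pow_le ((regularFamily_linearForms_iff hπ ha).1
      (regularFamily_linearForms_of_isCohenMacaulayRing hπ ha hI hm hA haP hPd)) ha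
  · intro h
    exact isCohenMacaulayRing_of_regularFamily_linearForms hπ ha hI hm haP
      ((regularFamily_linearForms_iff hπ ha).2 (initialFormsRegular_of_inf_pow_le hreg ha h))

end SallyModules

/-! ### The length one condition and the conclusion -/

namespace SallyModules

open IsLocalRing

theorem covBy_of_quotientLength_eq_one {R : Type*} [CommRing R] {M N : Ideal R} (h : N ≤ M)
    (hlen : quotientLength M N = 1) : N ⋖ M :=
  (covBy_iff_quot_is_simple h).2 (Module.length_eq_one_iff.1 hlen)

section

variable {R : Type*} [CommRing R] {I J : Ideal R}

theorem mul_pow_le_inf (hJI : J ≤ I) {k : ℕ} (hk : 1 ≤ k) : J * I ^ (k - 1) ≤ J ⊓ I ^ k := by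
  obtain ⟨k, rfl⟩ := Nat.exists_eq_add_of_le' hk
  refine le_inf Ideal.mul_le_left ?_
  rw [pow_succ']
  exact Ideal.mul_mono_left hJI

/-- The Valabrega-Valla equalities, when `J * I ^ n` is covered by `I ^ (n + 1)`. -/
theorem forall_inf_pow_le_iff_of_covBy [IsLocalRing R] [IsNoetherianRing R] (hJI : J ≤ I)
    (hIm : I ≤ maximalIdeal R) {n : ℕ} (hcov : J * I ^ n ⋖ I ^ (n + 1)) :
    (∀ k, J ⊓ I ^ k ≤ J * I ^ (k - 1)) ↔
      (∀ k : ℕ, 1 ≤ k → k ≤ n → J ⊓ I ^ k = J * I ^ (k - 1)) ∧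
        ¬ I ^ (n + 1) ≤ J ∧ I ^ (n + 2) = J * I ^ (n + 1) := by
  have hn := mul_pow_le_inf hJI (Nat.le_add_left 1 n)
  rw [Nat.add_sub_cancel] at hn
  constructor
  · intro h
    refine ⟨fun k hk _ => (h k).antisymm (mul_pow_le_inf hJI hk), fun hle => ?_, ?_⟩
    · exact hcov.lt.not_ge (by simpa [inf_eq_right.2 hle] using h (n + 1))
    · have hI2 : I ^ (n + 2) ≤ J := by
        -- By the covering, `J I^n + 𝔪 I^(n+1)` is one of the two ends; at the lower end the
        -- inclusion is immediate, at the upper end it follows from Nakayama.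
        have h1 : maximalIdeal R • I ^ (n + 1) ≤ J * I ^ n := by
          rcases hcov.wcovBy.eq_or_eq (le_sup_left (b := maximalIdeal R • I ^ (n + 1)))
            (sup_le hcov.le Submodule.smul_le_right) with h2 | h2
          · exact le_sup_right.trans h2.le
          · exact Submodule.smul_le_of_le_smul_of_le_jacobson_bot (IsNoetherian.noetherian _)
              (maximalIdeal_le_jacobson _) h2.ge
        calc I ^ (n + 2) = I * I ^ (n + 1) := pow_succ' _ _
          _ ≤ maximalIdeal R • I ^ (n + 1) := Ideal.mul_mono_left hIm
          _ ≤ J * I ^ n := h1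
          _ ≤ J := Ideal.mul_le_left
      refine le_antisymm ?_ ?_
      · simpa [inf_eq_right.2 hI2] using h (n + 2)
      · rw [pow_succ' I (n + 1)]
        exact Ideal.mul_mono_left hJI
  · rintro ⟨h1, h2, h3⟩ k
    rcases Nat.eq_zero_or_pos k with rfl | hk
    · simp
    rcases lt_trichotomy k (n + 1) with hkn | rfl | hkn
    · exact (h1 k hk (by omega)).le
    -- The intersection `J ⊓ I ^ (n + 1)` lies between the two ends of the covering and is not the
    -- upper one.
    · rcases hcov.wcovBy.eq_or_eq hn inf_le_right with h4 | h4
      · exact h4.le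
      · exact absurd (inf_eq_right.1 h4) h2
    · obtain ⟨k, rfl⟩ := Nat.exists_eq_add_of_le' hk
      rw [Nat.add_sub_cancel, ← IsReduction.pow_succ_eq h3 (by omega)]
      exact inf_le_right

end

/-- The `R`-algebra structure on `A` is defined through `p`, which makes `p` an algebra map by
definition. -/
theorem isCohenMacaulayRing_iff_inf_pow_le_of_surjective {R : Type*} [CommRing R] [IsLocalRing R]
    [Infinite (ResidueField R)] (hCM : IsCohenMacaulayLocalRing R) {I J : Ideal R}
    (hI : I.radical = maximalIdeal R) (hJ : IsMinimalReduction I J) {A : Type*} [CommRing A]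
    (p : reesAlgebra I →+* A) (hp : Function.Surjective p) (hker : ∀ f, p f = 0 ↔ f ∈ reesIdeal I) :
    IsCohenMacaulayRing A ↔ ∀ k, J ⊓ I ^ k ≤ J * I ^ (k - 1) := by
  let _ : Algebra R A := (p.comp (algebraMap R (reesAlgebra I))).toAlgebra
  let π : reesAlgebra I →ₐ[R] A := { p with commutes' := fun _ => rfl }
  refine isCohenMacaulayRing_iff_inf_pow_le hCM hI hJ (π := π) ⟨hp, hker⟩

theorem exists_surjective_eq_zero_iff_mem {S : Type*} [CommRing S] (K : Ideal S) :
    ∃ p : S →+* S ⧸ K, Function.Surjective p ∧ ∀ f, p f = 0 ↔ f ∈ K :=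
  ⟨Ideal.Quotient.mk K, Ideal.Quotient.mk_surjective, fun _ => Ideal.Quotient.eq_zero_iff_mem⟩

end SallyModules

theorem proposition3p1 {R : Type*} [CommRing R] [IsLocalRing R]
    (hCM : SallyModules.IsCohenMacaulayLocalRing R)
    (hdim : 0 < ringKrullDim R)
    (hres : Infinite (IsLocalRing.ResidueField R))
    (I J : Ideal R)
    (hI : I.IsPrimary ∧ I.radical = IsLocalRing.maximalIdeal R)
    (hJ : SallyModules.IsMinimalReduction I J)
    (n : ℕ)
    (hlen : SallyModules.quotientLength (I ^ (n + 1)) (J * I ^ n) = 1) :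
    SallyModules.IsCohenMacaulayRing (SallyModules.AssociatedGradedRing I) ↔
      (∀ k : ℕ, 1 ≤ k → k ≤ n → J ⊓ I ^ k = J * I ^ (k - 1)) ∧
        ¬ I ^ (n + 1) ≤ J ∧
        I ^ (n + 2) = J * I ^ (n + 1) := by
  have := hCM.isNoetherianRing
  have hIm : I ≤ IsLocalRing.maximalIdeal R := hI.2 ▸ Ideal.le_radical
  have hcov : J * I ^ n ⋖ I ^ (n + 1) := by
    refine SallyModules.covBy_of_quotientLength_eq_one ?_ hlen
    rw [pow_succ']
    exact Ideal.mul_mono_left hJ.1.1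
  obtain ⟨p, hp, hker⟩ :=
    SallyModules.exists_surjective_eq_zero_iff_mem (S := reesAlgebra I) (SallyModules.reesIdeal I)
  exact (SallyModules.isCohenMacaulayRing_iff_inf_pow_le_of_surjective hCM hI.2 hJ p hp hker).trans
    (SallyModules.forall_inf_pow_le_iff_of_covBy hJ.1.1 hIm hcov)
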